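/- **Setting.** Let $\mathcal X$ be a finite input alphabet, $\mathcal Y$ a measurable space with a measure $\mu(dy)$ (written $dy$), and $P$ a probability distribution on $\mathcal X$. For each $x\in\mathcal X$ let $k_x\ge 0$ be an integer, put $k=\sum_{x}k_x$, let $\Theta\subset\mathbb R^k$ with coordinates written $\theta^{j,x}$ ($x\in\mathcal X$, $1\le j\le k_x$), and let $\{W_\theta\}_{\theta\in\Theta}$ be a family of channels from $\mathcal X$ to $\mathcal Y$, where the output distribution $W_{\theta,x}$ at the input $x$ has a density $W_{\theta,x}(y)$ with respect to $dy$. For probability distributions $P',Q$ on $\mathcal Y$ and $s\ge -1$ put $sD_{1+s}(P'\|Q)=\log E_{P'}[(P'(Y)/Q(Y))^s]\in[-\infty,\infty]$, where $P'(y)/Q(y)$ is the ratio of densities with respect to a common dominating measure, equal to $\infty$ where $Q(y)=0<P'(y)$; for $s\neq0$ put $D_{1+s}(P'\|Q)=\frac1s\, sD_{1+s}(P'\|Q)$. For $s\in[0,1]$ put $$ sI_{1-s}(P,W)=-\sup_Q\log\sum_xP(x)e^{-sD_{1-s}(W_x\|Q)},$$ the supremum being over all probability distributions $Q$ on $\mathcal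 Y$. Assume that the family satisfies one of the following conditions. * **A (exponential family).** There are a channel $W_0$ with densities $W_{0,x}(y)$ and measurable functions $g_{j,x}$ on $\mathcal Y$ ($1\le j\le k_x$) such that $W_{\theta,x}(y)=W_{0,x}(y)\exp\big(\sum_{j=1}^{k_x}\theta^{j,x}g_{j,x}(y)-\phi_x(\theta)\big)$ for all $\theta\in\Theta$, $x\in\mathcal X$ and almost every $y$, where $e^{\phi_x(\theta)}=\int W_{0,x}(y)e^{\sum_j\theta^{j,x}g_{j,x}(y)}dy$ is finite and $\phi_x$ is $C^2$ on an open set containing $\Theta$. * **B.** $\Theta$ is compact, and for every $x$: (i) for every $s>0$ the map $(\theta,\theta')\mapsto D_{1+s}(W_{\theta,x}\|W_{\theta',x})$ is continuous on $\Theta\times\Theta$; (ii) the gradient $l_{\theta,x}(y)$ of $\theta\mapsto\log W_{\theta,x}(y)$ along $\Theta$ exists for $W_{\theta,x}$-almost every $y$, it is square integrable under $W_{\theta,x}$, and the Fisher information matrix $J_{\theta,x}=\int W_{\theta,x}(y)\,l_{\theta,x}(y)l_{\theta,x}(y)^{T}dy$ is continuous in $\theta\in\Theta$; (iii) for every $s>0$,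 as $\varepsilon\to0$ with $\theta+\varepsilon\in\Theta$, $2D_{1+s}(W_{\theta,x}\|W_{\theta+\varepsilon,x})=(1+s)\,\varepsilon^{T}J_{\theta,x}\varepsilon+o(\|\varepsilon\|^2)$, uniformly in $\theta\in\Theta$. * **C.** There are compact sets $\Theta_1\subset\Theta_2\subset\cdots\subset\Theta$ with $\bigcup_i\Theta_i=\Theta$, and for every $x$ the requirements (i)–(iii) of B hold, with "uniformly in $\theta\in\Theta$" replaced by "uniformly in $\theta$ on every compact subset of $\Theta$". A code $\Phi_n=(M_n,E_n,D_n)$ of block length $n$ consists of an encoder $E_n:\{1,\dots,M_n\}\to\mathcal X^n$ and a measurable decoder $D_n:\mathcal Y^n\to\{1,\dots,M_n\}$. Over the memoryless channel $W^n_{\theta,x^n}=\prod_{t=1}^n W_{\theta,x_t}$ its error probability is $e_\theta(\Phi_n)=\frac1{M_n}\sum_{i}\sum_{j\ne i}W^n_{\theta,E_n(i)}(D_n^{-1}(j))$. **Theorem 1.** Let $R,R_1$ be real numbers. Then there is a sequence of codes $\Phi_n$, not depending on $\theta$, of size $M_n=\lceil e^{nR}\rceil$, such that for every $\theta\in\Theta$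 $$\liminf_{n\to\infty}\frac{-1}{n}\log e_\theta(\Phi_n)\ \ge\ \min\Big(\sup_{s\in[0,1]}\big(sI_{1-s}(P,W_\theta)-sR_1\big),\ R_1-R\Big),$$ where $-\log 0=+\infty$. -/

import Mathlib

open MeasureTheory Filter Topology
open scoped ENNReal

namespace UniversalChannel

/-! ### Information quantities -/

section Information

variable {Y : Type*} [MeasurableSpace Y]

/-- The likelihood ratio `P(y) / Q(y)`, with values in `[0, ∞]`, computed from densities with
respect to the common dominating measure `P + Q`. It is `∞` where `P` has positive density and `Q`
has density zero. -/
noncomputable def likelihoodRatio (P Q : Measure Y) (y : Y) : ℝ≥0∞ :=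
  P.rnDeriv (P + Q) y / Q.rnDeriv (P + Q) y

/-- The function `s D_{1+s}(P‖Q) = log E_P[(P(X)/Q(X))^s]`, for real `s ≥ -1`, with values in the
extended reals. -/
noncomputable def sRenyiDiv (s : ℝ) (P Q : Measure Y) : EReal :=
  ENNReal.log (∫⁻ y, likelihoodRatio P Q y ^ s ∂P)

/-- The Rényi divergence `D_{1+s}(P‖Q) = s D_{1+s}(P‖Q) / s` (for `s ≠ 0`). -/
noncomputable def renyiDiv (s : ℝ) (P Q : Measure Y) : EReal :=
  ((s⁻¹ : ℝ) : EReal) * sRenyiDiv s P Q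

/-- The quantity `s I_{1-s}(P, W) = - sup_Q log ∑ₓ P(x) exp(-s D_{1-s}(Wₓ‖Q))`, where `Q` runs over
all probability distributions on the output alphabet. -/
noncomputable def sInfo {X : Type*} [Fintype X] (s : ℝ) (P : X → ℝ) (W : X → Measure Y) : EReal :=
  -(⨆ Q : ProbabilityMeasure Y,
      ENNReal.log (∑ x, ENNReal.ofReal (P x) * EReal.exp (sRenyiDiv (-s) (W x) (Q : Measure Y))))

end Information

/-! ### Families of channels -/

section Families

variable {X Y : Type*} [Fintype X] [MeasurableSpace Y]

/-- The parameter space `ℝᵏ` with `k = ∑ₓ kₓ`; the coordinates `θ^{j,x}` are indexed by `x` and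
`j = 1, …, kₓ`. -/
abbrev Param (k : X → ℕ) : Type _ := EuclideanSpace ℝ (Σ x : X, Fin (k x))

/-- `w x` is a probability density with respect to `μ`, for every input `x`. -/
def IsChannelDensity (μ : Measure Y) (w : X → Y → ℝ) : Prop :=
  ∀ x, Measurable (w x) ∧ (∀ y, 0 ≤ w x y) ∧ ∫⁻ y, ENNReal.ofReal (w x y) ∂μ = 1

/-- The output distribution `Wₓ(y) μ(dy)` of the channel with density `w` at the input `x`. -/
noncomputable def outputLaw (μ : Measure Y) (w : X → Y → ℝ) (x : X) : Measure Y :=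
  μ.withDensity fun y => ENNReal.ofReal (w x y)

/-- Exponential families of channels: `W_{θ,x}(y) = W_{0,x}(y) exp(∑ⱼ θ^{j,x} g_{j,x}(y) - φₓ(θ))`,
where `φₓ` is the cumulant generating function of the generators. The latter is finite and `C²` on
`Θ` in the usual sense for sets that need not be open, that is, on an open set `U` containing `Θ`.
The base channel `W₀` need not belong to the family. -/
def ConditionA (μ : Measure Y) (k : X → ℕ) (Θ : Set (Param k))
    (w : Param k → X → Y → ℝ) : Prop :=
  ∃ (w₀ : X → Y → ℝ) (g : (x : X) → Fin (k x) → Y → ℝ) (φ : X → Param k → ℝ)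
    (U : Set (Param k)),
    IsChannelDensity μ w₀ ∧ (∀ x j, Measurable (g x j)) ∧ IsOpen U ∧ Θ ⊆ U ∧
    (∀ θ ∈ Θ, ∀ x, ∀ᵐ y ∂μ,
      w θ x y = w₀ x y * Real.exp ((∑ j, θ ⟨x, j⟩ * g x j y) - φ x θ)) ∧
    (∀ θ ∈ U, ∀ x,
      ∫⁻ y, ENNReal.ofReal (w₀ x y * Real.exp (∑ j, θ ⟨x, j⟩ * g x j y)) ∂μ
        = ENNReal.ofReal (Real.exp (φ x θ))) ∧
    (∀ x, ContDiffOn ℝ 2 (φ x) U)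

/-- `l` is the likelihood ratio derivative `l_{θ,x} = d/dθ log W_{θ,x}` of the family at the input
`x`: for `W_{θ,x}`-almost every `y`, the map `θ' ↦ W_{θ',x}(y)` is positive near `θ` and `l θ y` is
a gradient of its logarithm at `θ`, along `Θ`. -/
def IsScore (μ : Measure Y) {k : X → ℕ} (Θ : Set (Param k)) (w : Param k → X → Y → ℝ) (x : X)
    (l : Param k → Y → Param k) : Prop :=
  ∀ θ ∈ Θ, ∀ᵐ y ∂(outputLaw μ (w θ) x),
    (∀ᶠ θ' in 𝓝[Θ] θ, 0 < w θ' x y) ∧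
    HasGradientWithinAt (fun θ' => Real.log (w θ' x y)) (l θ y) Θ θ

/-- The Fisher information matrix `J_{ij} = E_ν[l_i l_j]` of a score `l` under the law `ν`. -/
noncomputable def fisher {ι : Type*} (ν : Measure Y) (l : Y → EuclideanSpace ℝ ι) :
    Matrix ι ι ℝ :=
  Matrix.of fun i j => ∫ y, l y i * l y j ∂ν

/-- The regularity requirements on the divergences of the family. For every `s > 0` and every `x`:
`(θ, θ') ↦ D_{1+s}(W_{θ,x}‖W_{θ',x})` is continuous on `Θ × Θ`; the likelihood ratio derivative
exists; `2 D_{1+s}(W_{θ,x}‖W_{θ+ε,x}) = (1+s) εᵀ J_{θ,x} ε + o(‖ε‖²)` as `ε → 0`,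
uniformly for `θ` in each set of the collection `𝒦`; and `θ ↦ J_{θ,x}` is continuous on `Θ`. -/
def DivergenceRegular (μ : Measure Y) {k : X → ℕ} (Θ : Set (Param k))
    (w : Param k → X → Y → ℝ) (𝒦 : Set (Set (Param k))) : Prop :=
  ∀ x,
    (∀ s : ℝ, 0 < s →
      ContinuousOn
        (fun p : Param k × Param k =>
          renyiDiv s (outputLaw μ (w p.1) x) (outputLaw μ (w p.2) x)) (Θ ×ˢ Θ)) ∧
    ∃ l : Param k → Y → Param k,
      IsScore μ Θ w x l ∧
      (∀ θ ∈ Θ, MemLp (l θ) 2 (outputLaw μ (w θ) x)) ∧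
      ContinuousOn (fun θ => fisher (outputLaw μ (w θ) x) (l θ)) Θ ∧
      ∀ s : ℝ, 0 < s → ∀ K ∈ 𝒦, ∀ η : ℝ, 0 < η → ∃ δ : ℝ, 0 < δ ∧
        ∀ θ ∈ K, ∀ ε : Param k, θ + ε ∈ Θ → ‖ε‖ < δ →
          renyiDiv s (outputLaw μ (w θ) x) (outputLaw μ (w (θ + ε)) x) ≠ ⊤ ∧
          |2 * (renyiDiv s (outputLaw μ (w θ) x) (outputLaw μ (w (θ + ε)) x)).toReal
              - (1 + s) * ∑ i, ∑ j, fisher (outputLaw μ (w θ) x) (l θ) i j * ε i * ε j|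
            ≤ η * ‖ε‖ ^ 2

/-- Compact parameter space, with expansion of the divergences uniform on `Θ`. -/
def ConditionB (μ : Measure Y) (k : X → ℕ) (Θ : Set (Param k))
    (w : Param k → X → Y → ℝ) : Prop :=
  IsCompact Θ ∧ DivergenceRegular μ Θ w {Θ}

/-- Parameter space exhausted by an increasing sequence of compact subsets, with expansion of the
divergences uniform on every compact subset of `Θ`. -/
def ConditionC (μ : Measure Y) (k : X → ℕ) (Θ : Set (Param k))
    (w : Param k → X → Y → ℝ) : Prop :=
  (∃ T : ℕ → Set (Param k),
    (∀ i, IsCompact (T i) ∧ T i ⊆ Θ ∧ T i ⊆ T (i + 1)) ∧ ∀ θ ∈ Θ, ∃ i, θ ∈ T i) ∧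
  DivergenceRegular μ Θ w {K | IsCompact K ∧ K ⊆ Θ}

end Families

/-! ### Codes -/

/-- A code of block length `n`: a number of messages, an encoder and a (measurable) decoder. -/
structure Code (X Y : Type*) [MeasurableSpace Y] (n : ℕ) where
  size : ℕ
  encoder : Fin size → (Fin n → X)
  decoder : (Fin n → Y) → Fin size
  measurable_decoder : Measurable decoder

/-- The average decoding error probability of the code over the `n`-fold memoryless channel:
`(1/M) ∑ᵢ ∑_{j ≠ i} Wⁿ_{E(i)}(D⁻¹(j))`. -/
noncomputable def Code.errorProb {X Y : Type*} [MeasurableSpace Y] {n : ℕ}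
    (Φ : Code X Y n) (W : X → Measure Y) : ℝ≥0∞ :=
  (Φ.size : ℝ≥0∞)⁻¹ * ∑ i, ∑ j ∈ Finset.univ.filter (fun j => j ≠ i),
    Measure.pi (fun t => W (Φ.encoder i t)) (Φ.decoder ⁻¹' {j})

end UniversalChannel

/-!
The proof combines random coding for a countable subfamily with a change of measure.

*A countable subfamily.* Write `E θ` for the supremum over `s` of the first exponent. The graph of
`E` is a subset of a second countable space, hence has a countable dense subset, and so there are
countably many `θᵢ ∈ Θ` such that every `θ ∈ Θ` is approached by `θᵢ` with `E θᵢ` arbitrarily close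
to `E θ` from below or exceeding it (`exists_seq_dense_graph`). No continuity of `E` is needed.

*A code for the subfamily.* Give `θᵢ` a weight `λᵢ > 0`, with total mass at most one. A codeword `z` is
tested by comparing its likelihood under the mixture of the `W_{θᵢ}` with `e^{nR₁}` times the mean
of these likelihoods over all words, and the decoder takes the first accepted message. The mixture
is at least `λᵢ W_{θᵢ}`, so under each `W_{θᵢ}` a false alarm has probability at most
`λᵢ⁻¹ e^{-nR₁}`, and a miss has probability at most `(e^{nR₁} / λᵢ)^s e^{-n s I_{1-s}}`
(`sum_miss_le`). For the latter, `s I_{1-s}` is an infimum over all output laws `Q`, so it controls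
also the output law of the mixture, which is not a product: the single-letter inequality
`∫ F q^s ≤ g (∫ q)^s` holds for every density `q` (`single_letter_bound`) and is integrated one
coordinate at a time (`lintegral_pi_prod_mul_rpow_le`). By the Markov inequality with the weights
`λᵢ`, one codebook meets the random coding bound for all `i` up to constant factors
(`exists_forall_le_div`, `exists_code_countable`).

*Change of measure.* Under each of the three conditions, `E_{W_θ}[(W_θ / W_{θ'})^t]` is close to
one for `θ'` near `θ`, for every `t > 0`: by continuity of the divergence at the diagonal, or of
the cumulant generating function. By the Hölder inequality the error probability under `W_θ` is
then at most `e^{nε}` times the power `t / (1 + t)` of that under `W_{θᵢ}`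
(`Code.errorProb_le_of_moment`), and `t` can be taken large and `ε` small. The constants depending
on `i` disappear in the exponent.
-/

namespace UniversalChannel

/-! ### Integrals over finite products -/

section Product

variable {Y : Type*} [MeasurableSpace Y]

theorem lintegral_pi_succ {n : ℕ} (ν : Fin (n + 1) → Measure Y) [∀ i, SigmaFinite (ν i)]
    {G : (Fin (n + 1) → Y) → ℝ≥0∞} (hG : Measurable G) :
    ∫⁻ y, G y ∂(Measure.pi ν)
      = ∫⁻ z, ∫⁻ a, G (Fin.cons a z) ∂(ν 0) ∂(Measure.pi fun i => ν i.succ) := by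
  have h := (measurePreserving_piFinSuccAbove ν 0).symm
  rw [← h.lintegral_comp hG, lintegral_prod_symm']
  · simp [MeasurableEquiv.piFinSuccAbove, Fin.insertNthEquiv, Fin.insertNth_zero']
  · exact hG.comp (MeasurableEquiv.measurable _)

theorem measurable_cons {n : ℕ} :
    Measurable fun p : (Fin n → Y) × Y => (Fin.cons p.2 p.1 : Fin (n + 1) → Y) := by
  refine measurable_pi_iff.2 fun i => ?_
  refine Fin.cases ?_ (fun j => ?_) i
  · simpa using measurable_snd
  · simpa using measurable_fst.eval

theorem lintegral_pi_prod {n : ℕ} (ν : Fin n → Measure Y) [∀ i, SigmaFinite (ν i)]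
    {f : Fin n → Y → ℝ≥0∞} (hf : ∀ i, Measurable (f i)) :
    ∫⁻ y, ∏ i, f i (y i) ∂(Measure.pi ν) = ∏ i, ∫⁻ a, f i a ∂(ν i) := by
  induction n with
  | zero => simp
  | succ n ih =>
    have hm : ∀ i, Measurable fun y : Fin (n + 1) → Y => f i (y i) :=
      fun i => (hf i).comp (measurable_pi_apply i)
    rw [lintegral_pi_succ ν (Finset.measurable_prod _ fun i _ => hm i), Fin.prod_univ_succ]
    simp only [Fin.prod_univ_succ, Fin.cons_zero, Fin.cons_succ]
    simp_rw [lintegral_mul_const _ (hf 0)]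
    rw [lintegral_const_mul _ (Finset.measurable_prod _ fun i _ =>
      (hf i.succ).comp (measurable_pi_apply i)), ih _ fun i => hf i.succ]

theorem pi_withDensity {n : ℕ} (ν : Fin n → Measure Y) [∀ i, SigmaFinite (ν i)]
    {f : Fin n → Y → ℝ≥0∞} (hf : ∀ i, Measurable (f i))
    [∀ i, SigmaFinite ((ν i).withDensity (f i))] :
    Measure.pi (fun i => (ν i).withDensity (f i))
      = (Measure.pi ν).withDensity fun y => ∏ i, f i (y i) := by
  refine Measure.pi_eq fun s hs => ?_
  rw [withDensity_apply _ (MeasurableSet.univ_pi hs), ← lintegral_indicator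
    (MeasurableSet.univ_pi hs)]
  simp_rw [withDensity_apply _ (hs _), ← lintegral_indicator (hs _)]
  rw [← lintegral_pi_prod ν fun i => (hf i).indicator (hs i)]
  refine lintegral_congr fun y => ?_
  by_cases hy : y ∈ Set.univ.pi s
  · rw [Set.indicator_of_mem hy]
    exact Finset.prod_congr rfl fun i _ => (Set.indicator_of_mem (hy i trivial) _).symm
  · rw [Set.indicator_of_notMem hy]
    obtain ⟨i, hi⟩ : ∃ i, y i ∉ s i := by simpa [Set.mem_pi] using hy
    exact (Finset.prod_eq_zero (Finset.mem_univ i) (Set.indicator_of_notMem hi _)).symm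

/-- An inequality `∫ F q^s ≤ g (∫ q)^s`, valid for all `q ≥ 0`, tensorizes. -/
theorem lintegral_pi_prod_mul_rpow_le {ν : Measure Y} [SigmaFinite ν] {F : Y → ℝ≥0∞}
    (hF : Measurable F) {s : ℝ} {g : ℝ≥0∞}
    (h : ∀ q : Y → ℝ≥0∞, Measurable q → ∫⁻ y, F y * q y ^ s ∂ν ≤ g * (∫⁻ y, q y ∂ν) ^ s)
    (n : ℕ) (q : (Fin n → Y) → ℝ≥0∞) (hq : Measurable q) :
    ∫⁻ y, (∏ t, F (y t)) * q y ^ s ∂(Measure.pi fun _ => ν)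
      ≤ g ^ n * (∫⁻ y, q y ∂(Measure.pi fun _ => ν)) ^ s := by
  induction n with
  | zero =>
    rw [Measure.pi_of_empty]
    simp [lintegral_dirac' _ hq, lintegral_dirac' _ (hq.pow_const s)]
  | succ n ih =>
    have hP : ∀ m, Measurable fun y : Fin m → Y => ∏ t, F (y t) := fun m =>
      Finset.measurable_prod _ fun i _ => hF.comp (measurable_pi_apply i)
    have hq2 : Measurable fun p : (Fin n → Y) × Y => q (Fin.cons p.2 p.1) :=
      hq.comp measurable_cons
    have hq1 : ∀ z : Fin n → Y, Measurable fun a => q (Fin.cons a z) := fun z =>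
      hq2.comp measurable_prodMk_left
    rw [lintegral_pi_succ (fun _ => ν)
        (G := fun y => (∏ t, F (y t)) * q y ^ s) ((hP _).mul (hq.pow_const s)),
      lintegral_pi_succ (fun _ => ν) hq]
    have hq' : Measurable fun z : Fin n → Y => ∫⁻ a, q (Fin.cons a z) ∂ν :=
      hq2.lintegral_prod_right'
    calc ∫⁻ z, ∫⁻ a, (∏ t, F ((Fin.cons a z : Fin (n + 1) → Y) t)) * q (Fin.cons a z) ^ s ∂ν
            ∂(Measure.pi fun _ => ν)
        = ∫⁻ z, (∏ t, F (z t)) * ∫⁻ a, F a * q (Fin.cons a z) ^ s ∂ν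
            ∂(Measure.pi fun _ => ν) := by
          refine lintegral_congr fun z => ?_
          have hm : Measurable fun a => F a * q (Fin.cons a z) ^ s :=
            hF.mul ((hq1 z).pow_const s)
          rw [← lintegral_const_mul _ hm]
          refine lintegral_congr fun a => ?_
          rw [Fin.prod_univ_succ]
          simp only [Fin.cons_zero, Fin.cons_succ]
          ring
      _ ≤ ∫⁻ z, g * ((∏ t, F (z t)) * (∫⁻ a, q (Fin.cons a z) ∂ν) ^ s)
            ∂(Measure.pi fun _ => ν) := by
          refine lintegral_mono fun z => ?_
          calc _ ≤ (∏ t, F (z t)) * (g * (∫⁻ a, q (Fin.cons a z) ∂ν) ^ s) := by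
                gcongr
                exact h _ (hq1 z)
            _ = _ := by ring
      _ ≤ g * (g ^ n * (∫⁻ z, ∫⁻ a, q (Fin.cons a z) ∂ν ∂(Measure.pi fun _ => ν)) ^ s) := by
          have hm : Measurable fun z : Fin n → Y =>
              (∏ t, F (z t)) * (∫⁻ a, q (Fin.cons a z) ∂ν) ^ s :=
            (hP n).mul (hq'.pow_const s)
          rw [lintegral_const_mul _ hm]
          gcongr
          exact ih _ hq'
      _ = _ := by rw [pow_succ]; ring

end Product

/-! ### Likelihood ratios and densities -/

section Ratio

variable {Y : Type*} [MeasurableSpace Y]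

/-- The likelihood ratio is the quotient of the densities with respect to any measure dominating
both laws. -/
theorem likelihoodRatio_withDensity {ν : Measure Y} {p q : Y → ℝ≥0∞} (hp : Measurable p)
    (hq : Measurable q) (hp' : ∫⁻ y, p y ∂ν ≠ ∞) (hq' : ∫⁻ y, q y ∂ν ≠ ∞) :
    ∀ᵐ y ∂(ν.withDensity p),
      likelihoodRatio (ν.withDensity p) (ν.withDensity q) y = p y / q y := by
  have hadd : ν.withDensity p + ν.withDensity q = ν.withDensity (p + q) :=
    (withDensity_add_left hp q).symm
  have : IsFiniteMeasure (ν.withDensity p) := isFiniteMeasure_withDensity hp'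
  have : IsFiniteMeasure (ν.withDensity q) := isFiniteMeasure_withDensity hq'
  have hfin : ∀ᵐ y ∂ν, p y + q y < ∞ := by
    filter_upwards [ae_lt_top hp hp', ae_lt_top hq hq'] with y h1 h2
    exact ENNReal.add_lt_top.2 ⟨h1, h2⟩
  have key : ∀ r : Y → ℝ≥0∞, Measurable r → (∀ y, r y ≤ p y + q y) →
      (ν.withDensity r).rnDeriv (ν.withDensity p + ν.withDensity q)
        =ᵐ[ν.withDensity p + ν.withDensity q] fun y => r y / (p y + q y) := by
    intro r hr hle
    have hr' : ν.withDensity r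
        = (ν.withDensity p + ν.withDensity q).withDensity fun y => r y / (p y + q y) := by
      have hm : Measurable fun y => r y / (p y + q y) := hr.div (hp.add hq)
      rw [hadd, ← withDensity_mul _ (hp.add hq) hm]
      refine withDensity_congr_ae ?_
      filter_upwards [hfin] with y hy
      by_cases h0 : p y + q y = 0
      · have : r y = 0 := le_antisymm ((hle y).trans_eq h0) bot_le
        simp [this]
      · simp only [Pi.mul_apply, Pi.add_apply]
        exact (ENNReal.mul_div_cancel h0 hy.ne).symm
    conv_lhs => rw [hr']
    exact Measure.rnDeriv_withDensity _ (hr.div (hp.add hq))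
  have hac : ν.withDensity p ≪ ν.withDensity p + ν.withDensity q :=
    Measure.AbsolutelyContinuous.rfl.add_right _
  have hpos : ∀ᵐ y ∂(ν.withDensity p), p y ≠ 0 :=
    (ae_withDensity_iff hp).2 (Eventually.of_forall fun _ h => h)
  filter_upwards [hac.ae_le (key p hp fun y => le_self_add),
    hac.ae_le (key q hq fun y => le_add_self), hpos,
    (withDensity_absolutelyContinuous ν p).ae_le hfin] with y h1 h2 h3 h4
  rw [likelihoodRatio, h1, h2]
  have h0 : p y + q y ≠ 0 := by simp [h3]
  rw [div_eq_mul_inv (p y), div_eq_mul_inv (q y)]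
  exact ENNReal.mul_div_mul_right _ _ (ENNReal.inv_ne_zero.2 h4.ne) (ENNReal.inv_ne_top.2 h0)

theorem lintegral_likelihoodRatio_rpow {ν : Measure Y} {p q : Y → ℝ≥0∞} (hp : Measurable p)
    (hq : Measurable q) (hp' : ∫⁻ y, p y ∂ν ≠ ∞) (hq' : ∫⁻ y, q y ∂ν ≠ ∞) (r : ℝ) :
    ∫⁻ y, likelihoodRatio (ν.withDensity p) (ν.withDensity q) y ^ r ∂(ν.withDensity p)
      = ∫⁻ y, p y * (p y / q y) ^ r ∂ν := by
  rw [lintegral_congr_ae (g := fun y => (p y / q y) ^ r)]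
  · have hm : Measurable fun y => (p y / q y) ^ r := (hp.div hq).pow_const r
    rw [lintegral_withDensity_eq_lintegral_mul _ hp hm]
    rfl
  · filter_upwards [likelihoodRatio_withDensity hp hq hp' hq'] with y hy
    rw [hy]

theorem likelihoodRatio_self (P : Measure Y) [IsFiniteMeasure P] :
    ∀ᵐ y ∂P, likelihoodRatio P P y = 1 := by
  have h := likelihoodRatio_withDensity (ν := P) (p := fun _ => 1) (q := fun _ => 1)
    measurable_const measurable_const (by simp) (by simp)
  simpa using h

theorem lintegral_likelihoodRatio_self (P : Measure Y) [IsProbabilityMeasure P] (r : ℝ) :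
    ∫⁻ y, likelihoodRatio P P y ^ r ∂P = 1 := by
  rw [lintegral_congr_ae (g := fun _ => 1)]
  · simp
  · filter_upwards [likelihoodRatio_self P] with y hy
    simp [hy]

/-- The likelihood ratio is infinite where `Q` has density zero, so that a finite moment of it
forces absolute continuity. -/
theorem absolutelyContinuous_of_lintegral_likelihoodRatio {P Q : Measure Y} [IsFiniteMeasure P]
    [IsFiniteMeasure Q] {r : ℝ} (hr : 0 < r)
    (h : ∫⁻ y, likelihoodRatio P Q y ^ r ∂P ≠ ∞) : P ≪ Q := by
  have hm : Measurable fun y => likelihoodRatio P Q y ^ r :=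
    ((Measure.measurable_rnDeriv _ _).div (Measure.measurable_rnDeriv _ _)).pow_const r
  have hPS : P ≪ P + Q := Measure.AbsolutelyContinuous.rfl.add_right _
  have hQS : Q ≪ P + Q := by
    rw [add_comm]; exact Measure.AbsolutelyContinuous.rfl.add_right _
  have hQ : (P + Q).withDensity (Q.rnDeriv (P + Q)) = Q := Measure.withDensity_rnDeriv_eq _ _ hQS
  have hne : ∀ᵐ y ∂P, Q.rnDeriv (P + Q) y ≠ 0 := by
    filter_upwards [ae_lt_top hm h, Measure.rnDeriv_pos hPS] with y hy hy' h0
    rw [likelihoodRatio, h0, ENNReal.div_zero hy'.ne', ENNReal.top_rpow_of_pos hr] at hy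
    exact lt_irrefl _ hy
  refine Measure.AbsolutelyContinuous.mk fun N hN hN0 => ?_
  have h1 : ∀ᵐ y ∂(P + Q), y ∉ N ∨ Q.rnDeriv (P + Q) y = 0 := by
    have h2 : ∀ᵐ y ∂Q, y ∉ N := by simpa [ae_iff] using hN0
    rw [← hQ, ae_withDensity_iff (Measure.measurable_rnDeriv _ _)] at h2
    filter_upwards [h2] with y hy
    tauto
  have h3 : ∀ᵐ y ∂P, y ∉ N := by
    filter_upwards [hne, hPS.ae_le h1] with y a b
    tauto
  simpa [ae_iff] using h3

end Ratio

/-! ### Random codebooks and the test decoder -/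

section RandomCoding

variable {Z : Type*} [Fintype Z]

/-- The marginal of one codeword of a random codebook with independent codewords of law `π`. -/
theorem sum_prod_mul_apply {M : ℕ} {π : Z → ℝ≥0∞} (hπ : ∑ z, π z = 1) (m : Fin M)
    (a : Z → ℝ≥0∞) :
    ∑ x : Fin M → Z, (∏ l, π (x l)) * a (x m) = ∑ z, π z * a z := by
  classical
  have h := Finset.prod_univ_sum (fun _ : Fin M => (Finset.univ : Finset Z))
    fun l z => π z * if l = m then a z else 1
  rw [Fintype.piFinset_univ] at h
  rw [Finset.prod_eq_single m] at h
  · simp only [if_true] at h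
    rw [h]
    refine Finset.sum_congr rfl fun x _ => ?_
    rw [Finset.prod_mul_distrib]
    simp
  · intro l _ hl
    simp [hl, hπ]
  · simp

/-- The joint law of two different codewords of a random codebook. -/
theorem sum_prod_mul_apply_apply {M : ℕ} {π : Z → ℝ≥0∞} (hπ : ∑ z, π z = 1) {m j : Fin M}
    (hmj : j ≠ m) (a : Z → Z → ℝ≥0∞) :
    ∑ x : Fin M → Z, (∏ l, π (x l)) * a (x m) (x j) = ∑ z, π z * ∑ z', π z' * a z' z := by
  classical
  have key : ∀ w, ∑ x : Fin M → Z, (∏ l, π (x l)) * (if x j = w then a (x m) w else 0)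
      = π w * ∑ z', π z' * a z' w := by
    intro w
    have h := Finset.prod_univ_sum (fun _ : Fin M => (Finset.univ : Finset Z))
      fun l z => π z * ((if l = m then a z w else 1) * if l = j then (if z = w then 1 else 0) else 1)
    rw [Fintype.piFinset_univ] at h
    rw [Finset.prod_eq_mul m j hmj.symm] at h
    · simp only [if_true, hmj, hmj.symm, if_false, mul_one, one_mul] at h
      simp only [mul_ite, mul_one, mul_zero, Finset.sum_ite_eq', Finset.mem_univ, if_true] at h
      rw [mul_comm, h]
      refine Finset.sum_congr rfl fun x _ => ?_
      by_cases hx : x j = w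
      · rw [if_pos hx, ← Finset.mul_prod_erase _ _ (Finset.mem_univ m),
          ← Finset.mul_prod_erase _ (fun l => ite _ _ _) (Finset.mem_univ m)]
        have : ∀ l ∈ Finset.univ.erase m,
            (if l = j then (if x l = w then if l = m then π (x l) * a (x l) w else π (x l) else 0)
              else if l = m then π (x l) * a (x l) w else π (x l)) = π (x l) := by
          intro l hl
          have hlm : l ≠ m := Finset.ne_of_mem_erase hl
          by_cases hlj : l = j
          · subst hlj; simp [hlm, hx]
          · simp [hlm, hlj]
        rw [Finset.prod_congr rfl this]
        simp [hmj.symm]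
        ring
      · rw [if_neg hx, mul_zero]
        symm
        exact Finset.prod_eq_zero (Finset.mem_univ j) (by simp [hx])
    · intro l _ hl
      simp [hl.1, hl.2, hπ]
    · simp
    · simp
  simp_rw [← key]
  rw [Finset.sum_comm]
  refine Finset.sum_congr rfl fun x _ => ?_
  rw [← Finset.mul_sum]
  simp

/-- Given countably many nonnegative functions on a finite probability space and bounds on their
expectations, one point satisfies all the bounds up to the reciprocals of weights of total
mass at most one. -/
theorem exists_forall_le_div {C : Type*} [Fintype C] {ρ : C → ℝ≥0∞} (hρ : ∑ x, ρ x = 1)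
    {lam b : ℕ → ℝ≥0∞} (hlam : ∑' i, lam i ≤ 1) (hlam0 : ∀ i, lam i ≠ 0) (hb0 : ∀ i, b i ≠ 0)
    (hb : ∀ i, b i ≠ ∞) {e : ℕ → C → ℝ≥0∞} (he : ∀ i, ∑ x, ρ x * e i x ≤ b i) :
    ∃ x, ∀ i, e i x ≤ b i / lam i := by
  classical
  have hlamt : ∀ i, lam i ≠ ∞ := fun i =>
    ((ENNReal.le_tsum i).trans (hlam)).trans_lt ENNReal.one_lt_top |>.ne
  have hsum : ∑ x, ρ x * ∑' i, lam i * (e i x / b i) ≤ 1 := by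
    calc ∑ x, ρ x * ∑' i, lam i * (e i x / b i)
        = ∑' i, lam i * ((∑ x, ρ x * e i x) / b i) := by
          simp_rw [← ENNReal.tsum_mul_left]
          rw [← Summable.tsum_finsetSum fun _ _ => ENNReal.summable]
          refine tsum_congr fun i => ?_
          rw [div_eq_mul_inv, Finset.sum_mul, Finset.mul_sum]
          refine Finset.sum_congr rfl fun x _ => ?_
          rw [div_eq_mul_inv]; ring
      _ ≤ ∑' i, lam i * 1 := by
          gcongr with i
          exact ENNReal.div_le_of_le_mul (by simpa using he i)
      _ ≤ 1 := by simpa using hlam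
  have hex : ∃ x, ∑' i, lam i * (e i x / b i) ≤ 1 := by
    by_contra! hcon
    obtain ⟨x₀, hx₀⟩ : ∃ x, ρ x ≠ 0 := by
      by_contra! h0
      simp [h0] at hρ
    have hρt : ∀ x, ρ x ≠ ∞ := fun x h =>
      ENNReal.one_ne_top (hρ ▸ ENNReal.sum_eq_top.2 ⟨x, Finset.mem_univ x, h⟩)
    have : ∑ x, ρ x * 1 < ∑ x, ρ x * ∑' i, lam i * (e i x / b i) := by
      have hfin : ∀ x ∈ Finset.univ, ρ x * 1 ≠ ∞ := fun x _ => by simpa using hρt x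
      rw [← Finset.add_sum_erase _ _ (Finset.mem_univ x₀),
        ← Finset.add_sum_erase _ (fun x => ρ x * ∑' i, lam i * (e i x / b i))
          (Finset.mem_univ x₀)]
      refine ENNReal.add_lt_add_of_lt_of_le
        (ENNReal.sum_ne_top.2 fun x hx => hfin x (Finset.mem_univ x)) ?_ ?_
      · exact (ENNReal.mul_lt_mul_iff_right hx₀ (hρt x₀)).2 (hcon x₀)
      · exact Finset.sum_le_sum fun x _ => by gcongr; exact (hcon x).le
    rw [Finset.sum_congr rfl fun x _ => mul_one (ρ x), hρ] at this
    exact absurd hsum (not_le.2 this)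
  obtain ⟨x, hx⟩ := hex
  refine ⟨x, fun i => ?_⟩
  have h1 : lam i * (e i x / b i) ≤ 1 := (ENNReal.le_tsum i).trans hx
  rw [ENNReal.le_div_iff_mul_le (Or.inl (hlam0 i)) (Or.inl (hlamt i))]
  rw [← mul_div_assoc, ENNReal.div_le_iff (hb0 i) (hb i), one_mul, mul_comm] at h1
  exact h1

variable {Ω : Type*}

open Classical in
/-- The decoder that picks the first message whose test accepts, and message `0` if no test
does. -/
noncomputable def firstDecoder {M : ℕ} [NeZero M] (A : Fin M → Set Ω) (y : Ω) : Fin M :=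
  (fun a : Fin M → Prop => if h : ∃ m, a m then Fin.find a h else 0) fun m => y ∈ A m

theorem mem_of_firstDecoder_ne {M : ℕ} [NeZero M] {A : Fin M → Set Ω} {y : Ω} {m : Fin M}
    (h : firstDecoder A y ≠ m) : y ∈ (A m)ᶜ ∪ ⋃ j ∈ Finset.univ.filter (· ≠ m), A j := by
  classical
  by_cases hy : ∃ m, y ∈ A m
  · right
    have h' := Fin.find_spec hy
    simp only [firstDecoder, dif_pos hy] at h
    simp only [Finset.mem_filter, Finset.mem_univ, true_and, Set.mem_iUnion]
    refine ⟨_, h, ?_⟩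
    convert h'
  · left
    exact fun hm => hy ⟨m, hm⟩

theorem measurable_firstDecoder [MeasurableSpace Ω] {M : ℕ} [NeZero M] {A : Fin M → Set Ω}
    (hA : ∀ m, MeasurableSet (A m)) : Measurable (firstDecoder A) := by
  classical
  have h : Measurable fun (y : Ω) (m : Fin M) => y ∈ A m :=
    measurable_pi_iff.2 fun m => (hA m).mem
  exact (Measurable.of_discrete (f := fun a : Fin M → Prop =>
    if h : ∃ m, a m then Fin.find a h else 0)).comp h

end RandomCoding

section Random

variable {Z Ω : Type*} [Fintype Z] [MeasurableSpace Ω]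

theorem measure_decoding_error_le {M : ℕ} [NeZero M] {A : Fin M → Set Ω}
    (hA : ∀ m, MeasurableSet (A m)) (U : Measure Ω) (m : Fin M) :
    ∑ j ∈ Finset.univ.filter (fun j => j ≠ m), U (firstDecoder A ⁻¹' {j})
      ≤ U (A m)ᶜ + ∑ j ∈ Finset.univ.filter (fun j => j ≠ m), U (A j) := by
  rw [← measure_biUnion_finset]
  · refine (measure_mono (t := (A m)ᶜ ∪ ⋃ j ∈ Finset.univ.filter (· ≠ m), A j) ?_).trans
      ((measure_union_le _ _).trans (by gcongr; exact measure_biUnion_finset_le _ _))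
    intro y hy
    simp only [Finset.mem_filter, Finset.mem_univ, true_and, Set.mem_iUnion, Set.mem_preimage,
      Set.mem_singleton_iff] at hy
    obtain ⟨j, hj, hj'⟩ := hy
    exact mem_of_firstDecoder_ne (by rw [hj']; exact hj)
  · intro i _ j _ hij
    exact Disjoint.preimage _ (by simpa using hij)
  · exact fun j _ => measurable_firstDecoder hA (measurableSet_singleton j)

/-- Average over random codebooks of the error probability of the test decoder: a miss of the test
of the sent codeword, plus a false alarm for one of the `M - 1` independent other codewords. -/
theorem sum_codebook_error_le {M : ℕ} [NeZero M] {π : Z → ℝ≥0∞} (hπ : ∑ z, π z = 1)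
    {A : Z → Set Ω} (hA : ∀ z, MeasurableSet (A z)) (U : Z → Measure Ω) {N : ℝ≥0∞}
    (hN : (M : ℝ≥0∞) ≤ N + 1) :
    ∑ x : Fin M → Z, (∏ l, π (x l)) * ((M : ℝ≥0∞)⁻¹ * ∑ m, ∑ j ∈ Finset.univ.filter
        (fun j => j ≠ m), U (x m) (firstDecoder (fun l => A (x l)) ⁻¹' {j}))
      ≤ ∑ z, π z * U z (A z)ᶜ + N * ∑ z, π z * ∑ z', π z' * U z' (A z) := by
  set α := ∑ z, π z * U z (A z)ᶜ with hα
  set β := ∑ z, π z * ∑ z', π z' * U z' (A z) with hβ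
  have hM0 : (M : ℝ≥0∞) ≠ 0 := by exact_mod_cast NeZero.ne M
  have hMt : (M : ℝ≥0∞) ≠ ∞ := ENNReal.natCast_ne_top M
  have hcard : ∀ m : Fin M,
      ((Finset.univ.filter (fun j : Fin M => j ≠ m)).card : ℝ≥0∞) ≤ N := by
    intro m
    have h1 : (Finset.univ.filter (fun j : Fin M => j ≠ m)).card + 1 = M := by
      rw [Finset.filter_ne' Finset.univ m, Finset.card_erase_add_one (Finset.mem_univ m)]
      simp
    have h2 : ((Finset.univ.filter (fun j : Fin M => j ≠ m)).card : ℝ≥0∞) + 1 ≤ N + 1 := by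
      refine le_trans (le_of_eq ?_) hN
      exact_mod_cast h1
    exact (ENNReal.add_le_add_iff_right ENNReal.one_ne_top).1 h2
  calc _ ≤ ∑ x : Fin M → Z, (∏ l, π (x l)) * ((M : ℝ≥0∞)⁻¹ * ∑ m, (U (x m) (A (x m))ᶜ
          + ∑ j ∈ Finset.univ.filter (fun j => j ≠ m), U (x m) (A (x j)))) := by
        gcongr with x _ m
        exact measure_decoding_error_le (fun l => hA (x l)) _ m
    _ = (M : ℝ≥0∞)⁻¹ * ∑ m, (∑ x : Fin M → Z, (∏ l, π (x l)) * U (x m) (A (x m))ᶜ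
          + ∑ j ∈ Finset.univ.filter (fun j => j ≠ m),
            ∑ x : Fin M → Z, (∏ l, π (x l)) * U (x m) (A (x j))) := by
        simp_rw [Finset.sum_comm (s := Finset.filter _ _) (t := Finset.univ),
          ← Finset.sum_add_distrib, Finset.sum_comm (s := (Finset.univ : Finset (Fin M)))
          (t := (Finset.univ : Finset (Fin M → Z))), Finset.mul_sum, mul_add, Finset.mul_sum]
        refine Finset.sum_congr rfl fun x _ => Finset.sum_congr rfl fun m _ => ?_
        congr 1
        · ring
        · exact Finset.sum_congr rfl fun j _ => by ring
    _ ≤ (M : ℝ≥0∞)⁻¹ * ∑ m : Fin M, (α + N * β) := by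
        gcongr with m _
        · exact (sum_prod_mul_apply hπ m fun z => U z (A z)ᶜ).le
        · calc _ = ∑ j ∈ Finset.univ.filter (fun j => j ≠ m), β :=
                Finset.sum_congr rfl fun j hj => sum_prod_mul_apply_apply hπ
                  (Finset.mem_filter.1 hj).2 fun z' z => U z' (A z)
            _ ≤ _ := by
                rw [Finset.sum_const, nsmul_eq_mul]
                gcongr
                exact hcard m
    _ = α + N * β := by
        rw [Finset.sum_const, nsmul_eq_mul, Finset.card_univ, Fintype.card_fin, ← mul_assoc,
          ENNReal.inv_mul_cancel hM0 hMt, one_mul]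

end Random

/-! ### The single-letter bound -/

section SingleLetter

variable {X Y : Type*} [Fintype X] [MeasurableSpace Y]

/-- The pointwise identity `p (p / q)^{-s} = p^{1-s} q^s`, with `p^{1-s}` written so that it
vanishes at `p = 0` also for `s = 1`. -/
theorem mul_div_rpow_neg {p q : ℝ≥0∞} (hp : p ≠ ∞) {s : ℝ} (hs : 0 < s) :
    p * (p / q) ^ (-s) = p * p ^ (-s) * q ^ s := by
  by_cases hp0 : p = 0
  · simp [hp0]
  · rw [mul_assoc]
    congr 1
    rw [ENNReal.rpow_neg, ENNReal.rpow_neg, ENNReal.div_rpow_of_nonneg _ _ hs.le,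
      ENNReal.inv_div (Or.inr (ENNReal.rpow_ne_top_of_nonneg hs.le hp))
      (Or.inr (by simp [ENNReal.rpow_eq_zero_iff, hp0, hp, not_lt.2 hs.le])),
      div_eq_mul_inv, mul_comm]

/-- The bound `g` on the sums in the definition of `s I_{1-s}`, for all probability measures `Q`,
rewritten in terms of densities and homogeneous in the density `q` of `Q`. It covers `s = 1`, where
`f^{1-s}` is the indicator of `f > 0`. -/
theorem single_letter_bound {ν : Measure Y} {f : X → Y → ℝ≥0∞} (hf : ∀ x, Measurable (f x))
    (hft : ∀ x y, f x y ≠ ∞) (hf1 : ∀ x, ∫⁻ y, f x y ∂ν = 1) {p : X → ℝ≥0∞} (hp : ∑ x, p x = 1)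
    {s : ℝ} (hs : 0 < s) {g : ℝ≥0∞}
    (hg : ∀ Q : ProbabilityMeasure Y, ∑ x, p x *
      ∫⁻ y, likelihoodRatio (ν.withDensity (f x)) Q y ^ (-s) ∂(ν.withDensity (f x)) ≤ g)
    (q : Y → ℝ≥0∞) (hq : Measurable q) :
    ∫⁻ y, (∑ x, p x * (f x y * f x y ^ (-s))) * q y ^ s ∂ν ≤ g * (∫⁻ y, q y ∂ν) ^ s := by
  have hprob : ∀ x, IsProbabilityMeasure (ν.withDensity (f x)) := fun x =>
    ⟨by simp [hf1 x]⟩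
  by_cases h0 : ∫⁻ y, q y ∂ν = 0
  · rw [lintegral_eq_zero_iff hq] at h0
    rw [lintegral_congr_ae (g := 0)]
    · simp
    · filter_upwards [h0] with y hy
      simp [hy, hs]
  by_cases htop : ∫⁻ y, q y ∂ν = ∞
  · -- `g` is positive, as the choice of an output law of the channel for `Q` shows.
    have hg0 : g ≠ 0 := by
      rintro rfl
      obtain ⟨x, hx⟩ : ∃ x, p x ≠ 0 := by
        by_contra! h
        simp [h] at hp
      have h1 := (Finset.single_le_sum (fun _ _ => zero_le) (Finset.mem_univ x)).trans
        (hg ⟨ν.withDensity (f x), hprob x⟩)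
      have h2 := lintegral_likelihoodRatio_self (ν.withDensity (f x)) (-s)
      simp only [ProbabilityMeasure.coe_mk] at h1
      rw [h2] at h1
      exact hx (by simpa using h1)
    rw [htop, ENNReal.top_rpow_of_pos hs, ENNReal.mul_top hg0]
    exact le_top
  set c := ∫⁻ y, q y ∂ν with hc
  have hq' : Measurable fun y => q y / c := hq.div_const c
  have hq1 : ∫⁻ y, q y / c ∂ν = 1 := by
    simp_rw [div_eq_mul_inv]
    rw [lintegral_mul_const _ hq, ← hc, ENNReal.mul_inv_cancel h0 htop]
  have key := hg ⟨ν.withDensity fun y => q y / c, ⟨by simp [hq1]⟩⟩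
  simp only [ProbabilityMeasure.coe_mk] at key
  have hF : ∀ x, Measurable fun y => f x y * f x y ^ (-s) := fun x =>
    (hf x).mul ((hf x).pow_const _)
  have hterm : ∀ x, ∫⁻ y, likelihoodRatio (ν.withDensity (f x)) (ν.withDensity fun y => q y / c) y
      ^ (-s) ∂(ν.withDensity (f x)) = (∫⁻ y, (f x y * f x y ^ (-s)) * q y ^ s ∂ν) / c ^ s := by
    intro x
    rw [lintegral_likelihoodRatio_rpow (hf x) hq' (by simp [hf1]) (by simp [hq1])]
    have hm : Measurable fun y => (f x y * f x y ^ (-s)) * q y ^ s :=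
      (hF x).mul (hq.pow_const s)
    rw [div_eq_mul_inv, ← lintegral_mul_const _ hm]
    refine lintegral_congr fun y => ?_
    rw [mul_div_rpow_neg (hft x y) hs, ENNReal.div_rpow_of_nonneg _ _ hs.le, div_eq_mul_inv,
      mul_assoc, mul_assoc, mul_assoc]
  simp_rw [hterm, ← mul_div_assoc, div_eq_mul_inv, ← Finset.sum_mul] at key
  rw [← div_eq_mul_inv, ENNReal.div_le_iff (by
    simp [ENNReal.rpow_eq_zero_iff, h0, not_lt.2 hs.le]) (ENNReal.rpow_ne_top_of_nonneg hs.le htop)]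
    at key
  refine le_trans (le_of_eq ?_) key
  simp_rw [Finset.sum_mul]
  have hm : ∀ x, Measurable fun y => f x y * f x y ^ (-s) * q y ^ s := fun x =>
    (hF x).mul (hq.pow_const s)
  have hm' : ∀ x, Measurable fun y => p x * (f x y * f x y ^ (-s)) * q y ^ s := fun x =>
    ((hF x).const_mul _).mul (hq.pow_const s)
  rw [lintegral_finsetSum _ fun x _ => hm' x]
  refine Finset.sum_congr rfl fun x _ => ?_
  rw [← lintegral_const_mul _ (hm x)]
  exact lintegral_congr fun y => by ring

theorem sum_prod_eq_prod_sum {n : ℕ} (a : X → Fin n → ℝ≥0∞) :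
    ∑ x : Fin n → X, ∏ t, a (x t) t = ∏ t, ∑ x, a x t := by
  classical
  rw [Finset.prod_univ_sum, Fintype.piFinset_univ]

end SingleLetter

/-! ### A code for a countable family of channels -/

section Miss

variable {X Y : Type*} [Fintype X] [MeasurableSpace Y]

theorem sum_prod_weight {p : X → ℝ≥0∞} (hp : ∑ x, p x = 1) (n : ℕ) :
    ∑ z : Fin n → X, ∏ t, p (z t) = 1 := by
  rw [sum_prod_eq_prod_sum fun x _ => p x]
  simp [hp]

/-- The probability that the test of the sent codeword fails. On the region of failure the
likelihood `u` of the codeword is at most `K q`, hence `u ≤ u^{1-s} (K q)^s`; the average over the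
codewords then factorizes up to `q^s`, where `q` may be any density on the product space. -/
theorem sum_miss_le {ν : Measure Y} [SigmaFinite ν] {f : X → Y → ℝ≥0∞}
    (hf : ∀ x, Measurable (f x)) (hft : ∀ x y, f x y ≠ ∞) (hf1 : ∀ x, ∫⁻ y, f x y ∂ν = 1)
    {p : X → ℝ≥0∞} (hp : ∑ x, p x = 1) {s : ℝ} (hs : 0 ≤ s) {g : ℝ≥0∞}
    (hg : ∀ Q : ProbabilityMeasure Y, ∑ x, p x *
      ∫⁻ y, likelihoodRatio (ν.withDensity (f x)) Q y ^ (-s) ∂(ν.withDensity (f x)) ≤ g)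
    {n : ℕ} {A : (Fin n → X) → Set (Fin n → Y)} (hA : ∀ z, MeasurableSet (A z))
    {q : (Fin n → Y) → ℝ≥0∞} (hq : Measurable q)
    (hq1 : ∫⁻ y, q y ∂(Measure.pi fun _ => ν) ≤ 1) {K : ℝ≥0∞}
    (hAK : ∀ z, ∀ y ∉ A z, ∏ t, f (z t) (y t) ≤ K * q y) :
    ∑ z : Fin n → X, (∏ t, p (z t)) *
      Measure.pi (fun t => ν.withDensity (f (z t))) (A z)ᶜ ≤ K ^ s * g ^ n := by
  have hprob : ∀ x, IsProbabilityMeasure (ν.withDensity (f x)) := fun x => ⟨by simp [hf1 x]⟩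
  rcases hs.eq_or_lt with rfl | hs
  · -- For `s = 0` the bound is at least one.
    obtain ⟨x, -⟩ : ∃ x, p x ≠ 0 := by
      by_contra! h
      simp [h] at hp
    have hg1 : 1 ≤ g := by
      have := hg ⟨ν.withDensity (f x), hprob x⟩
      simpa [hp, hf1] using this
    calc _ ≤ ∑ z : Fin n → X, (∏ t, p (z t)) * 1 := by
          gcongr
          exact prob_le_one
      _ = 1 := by simp [sum_prod_weight hp]
      _ ≤ _ := by simpa using one_le_pow₀ hg1
  set F : Y → ℝ≥0∞ := fun y => ∑ x, p x * (f x y * f x y ^ (-s)) with hFdef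
  have hφ : ∀ x, Measurable fun y => f x y * f x y ^ (-s) := fun x =>
    (hf x).mul ((hf x).pow_const _)
  have hF : Measurable F := Finset.measurable_sum _ fun x _ => (hφ x).const_mul _
  have hΦ : ∀ z : Fin n → X,
      Measurable fun y : Fin n → Y => ∏ t, f (z t) (y t) * f (z t) (y t) ^ (-s) := fun z =>
    Finset.measurable_prod _ fun t _ => (hφ (z t)).comp (measurable_pi_apply t)
  have hpt : ∀ z, ∀ y ∉ A z, ∏ t, f (z t) (y t)
      ≤ (∏ t, f (z t) (y t) * f (z t) (y t) ^ (-s)) * (K * q y) ^ s := by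
    intro z y hy
    have htop : ∏ t, f (z t) (y t) ≠ ∞ := ENNReal.prod_ne_top fun t _ => hft _ _
    rw [Finset.prod_mul_distrib, ENNReal.prod_rpow_of_ne_top fun t _ => hft _ _]
    by_cases h0 : ∏ t, f (z t) (y t) = 0
    · rw [h0]; exact zero_le
    · calc ∏ t, f (z t) (y t) = (∏ t, f (z t) (y t)) * (∏ t, f (z t) (y t)) ^ (-s)
            * (∏ t, f (z t) (y t)) ^ s := by
            rw [mul_assoc, ← ENNReal.rpow_add _ _ h0 htop]
            simp
        _ ≤ _ := by
            gcongr
            exact hAK z y hy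
  calc _ = ∑ z : Fin n → X, (∏ t, p (z t)) *
          ∫⁻ y in (A z)ᶜ, ∏ t, f (z t) (y t) ∂(Measure.pi fun _ => ν) := by
        refine Finset.sum_congr rfl fun z _ => ?_
        rw [pi_withDensity (fun _ => ν) fun t => hf (z t), withDensity_apply _ (hA z).compl]
    _ ≤ ∑ z : Fin n → X, (∏ t, p (z t)) * ∫⁻ y,
          (∏ t, f (z t) (y t) * f (z t) (y t) ^ (-s)) * (K * q y) ^ s
            ∂(Measure.pi fun _ => ν) := by
        refine Finset.sum_le_sum fun z _ => mul_le_mul_right ?_ _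
        exact (setLIntegral_mono' (hA z).compl fun y hy => hpt z y hy).trans
          (setLIntegral_le_lintegral _ _)
    _ = ∫⁻ y, K ^ s * ((∏ t, F (y t)) * q y ^ s) ∂(Measure.pi fun _ => ν) := by
        have hm : ∀ z : Fin n → X, Measurable fun y : Fin n → Y =>
            (∏ t, f (z t) (y t) * f (z t) (y t) ^ (-s)) * (K * q y) ^ s := fun z =>
          (hΦ z).mul ((hq.const_mul K).pow_const s)
        simp_rw [← lintegral_const_mul _ (hm _)]
        rw [← lintegral_finsetSum _ fun z _ => (hm z).const_mul _]
        refine lintegral_congr fun y => ?_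
        rw [hFdef, ← sum_prod_eq_prod_sum fun x t => p x * (f x (y t) * f x (y t) ^ (-s)),
          ENNReal.mul_rpow_of_nonneg _ _ hs.le, Finset.sum_mul, Finset.mul_sum]
        refine Finset.sum_congr rfl fun z _ => ?_
        rw [Finset.prod_mul_distrib (f := fun t => p (z t))]
        ring
    _ ≤ K ^ s * (g ^ n * 1) := by
        have hm : Measurable fun y : Fin n → Y => (∏ t, F (y t)) * q y ^ s :=
          (Finset.measurable_prod _ fun t _ => hF.comp (measurable_pi_apply t)).mul
            (hq.pow_const s)
        rw [lintegral_const_mul _ hm]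
        gcongr
        refine (lintegral_pi_prod_mul_rpow_le hF
          (single_letter_bound hf hft hf1 hp hs hg) n q hq).trans ?_
        gcongr
        exact ENNReal.rpow_le_one hq1 hs.le
    _ = _ := by rw [mul_one]

/-- One code for a countable family of channels. The test of a codeword `z` compares its likelihood
under the mixture of the family, with weights `lam`, with `c` times the mean of these likelihoods
over all words. -/
theorem exists_code_countable {ν : Measure Y} [SigmaFinite ν] {f : ℕ → X → Y → ℝ≥0∞}
    (hf : ∀ i x, Measurable (f i x)) (hft : ∀ i x y, f i x y ≠ ∞)
    (hf1 : ∀ i x, ∫⁻ y, f i x y ∂ν = 1) {p : X → ℝ≥0∞} (hp : ∑ x, p x = 1)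
    {lam : ℕ → ℝ≥0∞} (hlam : ∑' i, lam i ≤ 1) (hlam0 : ∀ i, lam i ≠ 0) (n : ℕ) {M : ℕ}
    (hM0 : M ≠ 0) {N c : ℝ≥0∞} (hN : (M : ℝ≥0∞) ≤ N + 1) (hN0 : N ≠ 0) (hNt : N ≠ ∞)
    (hc0 : c ≠ 0) (hct : c ≠ ∞) :
    ∃ Φ : Code X Y n, Φ.size = M ∧ ∀ i (s : ℝ) (g : ℝ≥0∞), 0 ≤ s →
      (∀ Q : ProbabilityMeasure Y, ∑ x, p x *
        ∫⁻ y, likelihoodRatio (ν.withDensity (f i x)) Q y ^ (-s) ∂(ν.withDensity (f i x)) ≤ g) →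
      Φ.errorProb (fun x => ν.withDensity (f i x))
        ≤ ((c / lam i) ^ s * g ^ n + N * (c⁻¹ / lam i)) / lam i := by
  have : NeZero M := ⟨hM0⟩
  have hprob : ∀ i x, IsProbabilityMeasure (ν.withDensity (f i x)) :=
    fun i x => ⟨by simp [hf1 i x]⟩
  have hlamt : ∀ i, lam i ≠ ∞ := fun i =>
    ((ENNReal.le_tsum i).trans hlam).trans_lt ENNReal.one_lt_top |>.ne
  set νn : Measure (Fin n → Y) := Measure.pi fun _ => ν with hνn
  set π : (Fin n → X) → ℝ≥0∞ := fun z => ∏ t, p (z t) with hπdef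
  have hπ : ∑ z, π z = 1 := sum_prod_weight hp n
  set u : ℕ → (Fin n → X) → (Fin n → Y) → ℝ≥0∞ := fun i z y => ∏ t, f i (z t) (y t) with hu
  have hum : ∀ i z, Measurable (u i z) := fun i z =>
    Finset.measurable_prod _ fun t _ => (hf i (z t)).comp (measurable_pi_apply t)
  have hu1 : ∀ i z, ∫⁻ y, u i z y ∂νn = 1 := fun i z => by
    simp [hu, hνn, lintegral_pi_prod (fun _ => ν) fun t => hf i (z t), hf1]
  set U : ℕ → (Fin n → X) → Measure (Fin n → Y) := fun i z =>
    Measure.pi fun t => ν.withDensity (f i (z t)) with hUdef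
  have hU : ∀ i z, U i z = νn.withDensity (u i z) := fun i z =>
    pi_withDensity (fun _ => ν) fun t => hf i (z t)
  set wb : (Fin n → X) → (Fin n → Y) → ℝ≥0∞ := fun z y => ∑' i, lam i * u i z y with hwb
  have hwbm : ∀ z, Measurable (wb z) := fun z =>
    Measurable.tsum fun i => (hum i z).const_mul _
  have hwb1 : ∀ z, ∫⁻ y, wb z y ∂νn ≤ 1 := by
    intro z
    rw [hwb, lintegral_tsum fun i => ((hum i z).const_mul _).aemeasurable]
    simp_rw [lintegral_const_mul _ (hum _ z), hu1, mul_one]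
    exact hlam
  have hle : ∀ i z y, lam i * u i z y ≤ wb z y := fun i z y =>
    ENNReal.le_tsum (f := fun i => lam i * u i z y) i
  set qb : (Fin n → Y) → ℝ≥0∞ := fun y => ∑ z, π z * wb z y with hqb
  have hqbm : Measurable qb := Finset.measurable_sum _ fun z _ => (hwbm z).const_mul _
  have hqb1 : ∫⁻ y, qb y ∂νn ≤ 1 := by
    rw [hqb, lintegral_finsetSum _ fun z _ => (hwbm z).const_mul _]
    simp_rw [lintegral_const_mul _ (hwbm _)]
    calc _ ≤ ∑ z, π z * 1 := by gcongr; exact hwb1 _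
      _ = 1 := by simp [hπ]
  set A : (Fin n → X) → Set (Fin n → Y) := fun z => {y | c * qb y < wb z y} with hAdef
  have hA : ∀ z, MeasurableSet (A z) := fun z =>
    measurableSet_lt (hqbm.const_mul c) (hwbm z)
  have hmiss : ∀ i (s : ℝ) (g : ℝ≥0∞), 0 ≤ s →
      (∀ Q : ProbabilityMeasure Y, ∑ x, p x *
        ∫⁻ y, likelihoodRatio (ν.withDensity (f i x)) Q y ^ (-s) ∂(ν.withDensity (f i x)) ≤ g) →
      ∑ z, π z * U i z (A z)ᶜ ≤ (c / lam i) ^ s * g ^ n := by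
    intro i s g hs hg
    refine sum_miss_le (hf i) (hft i) (hf1 i) hp hs hg hA hqbm hqb1 fun z y hy => ?_
    have h1 : lam i * u i z y ≤ c * qb y := (hle i z y).trans (not_lt.1 hy)
    rw [ENNReal.mul_comm_div, mul_comm c, div_eq_mul_inv, mul_assoc, mul_comm _ c, ← mul_assoc,
      mul_comm (qb y), ← div_eq_mul_inv, ENNReal.le_div_iff_mul_le (Or.inl (hlam0 i))
      (Or.inl (hlamt i)), mul_comm]
    exact h1
  have halarm : ∀ i, ∑ z, π z * ∑ z', π z' * U i z' (A z) ≤ c⁻¹ / lam i := by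
    intro i
    have hz : ∀ z, ∑ z', π z' * U i z' (A z) ≤ c⁻¹ / lam i := by
      intro z
      rw [ENNReal.le_div_iff_mul_le (Or.inl (hlam0 i)) (Or.inl (hlamt i)), ← one_mul c⁻¹,
        ← div_eq_mul_inv, ENNReal.le_div_iff_mul_le (Or.inl hc0) (Or.inl hct)]
      calc (∑ z', π z' * U i z' (A z)) * lam i * c
          = ∫⁻ y in A z, c * ∑ z', π z' * (lam i * u i z' y) ∂νn := by
            rw [lintegral_const_mul _ (Finset.measurable_sum _ fun z' _ =>
              ((hum i z').const_mul _).const_mul _), lintegral_finsetSum _ fun z' _ =>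
              ((hum i z').const_mul _).const_mul _, mul_comm, Finset.sum_mul]
            congr 1
            refine Finset.sum_congr rfl fun z' _ => ?_
            rw [lintegral_const_mul _ ((hum i z').const_mul _), lintegral_const_mul _ (hum i z'),
              hU, withDensity_apply _ (hA z)]
            ring
        _ ≤ ∫⁻ y in A z, wb z y ∂νn := by
            refine setLIntegral_mono' (hA z) fun y hy => le_trans ?_ (le_of_lt hy)
            gcongr
            exact Finset.sum_le_sum fun z' _ => by gcongr; exact hle i z' y
        _ ≤ 1 := (setLIntegral_le_lintegral _ _).trans (hwb1 z)
    calc _ ≤ ∑ z, π z * (c⁻¹ / lam i) := by gcongr; exact hz _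
      _ = c⁻¹ / lam i := by rw [← Finset.sum_mul, hπ, one_mul]
  set B : ℕ → ℝ≥0∞ := fun i => ∑ z, π z * U i z (A z)ᶜ + N * (c⁻¹ / lam i) with hB
  obtain ⟨x, hx⟩ := exists_forall_le_div (sum_prod_weight hπ M) hlam hlam0 (b := B)
    (fun i => by
      have : N * (c⁻¹ / lam i) ≠ 0 :=
        mul_ne_zero hN0 (ENNReal.div_ne_zero.2 ⟨ENNReal.inv_ne_zero.2 hct, hlamt i⟩)
      simp only [hB]
      exact fun h => this (add_eq_zero.1 h).2)
    (fun i => by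
      refine ENNReal.add_ne_top.2 ⟨ne_top_of_le_ne_top (b := 1) (by simp) ?_,
        ENNReal.mul_ne_top hNt (ENNReal.div_ne_top (ENNReal.inv_ne_top.2 hc0) (hlam0 i))⟩
      calc _ ≤ ∑ z, π z * 1 := by gcongr; exact prob_le_one
        _ = 1 := by simp [hπ])
    (fun i => (sum_codebook_error_le hπ hA (U i) hN).trans
      (add_le_add le_rfl (mul_le_mul_right (halarm i) N)))
  refine ⟨⟨M, x, _, measurable_firstDecoder fun m => hA (x m)⟩, rfl, fun i s g hs hg => ?_⟩
  refine (hx i).trans (ENNReal.div_le_div_right (add_le_add (hmiss i s g hs hg) le_rfl) _)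

end Miss

/-! ### Change of measure for error probabilities -/

section Transfer

variable {X Y : Type*} [MeasurableSpace Y]

/-- A moment of order `t` of the likelihood ratio bounds the probability of an event under one law
by a power of its probability under the other. -/
theorem measure_pi_le_of_moment {n : ℕ} {W V : Fin n → Measure Y}
    [∀ i, IsProbabilityMeasure (W i)] [∀ i, IsProbabilityMeasure (V i)] {t : ℝ} (ht : 0 < t)
    {L : ℝ≥0∞} (hL : L ≠ ∞) (h : ∀ i, ∫⁻ y, likelihoodRatio (W i) (V i) y ^ t ∂(W i) ≤ L)
    {A : Set (Fin n → Y)} (hA : MeasurableSet A) :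
    Measure.pi W A ≤ (L ^ n) ^ (1 / (1 + t)) * Measure.pi V A ^ (t / (1 + t)) := by
  set r : Fin n → Y → ℝ≥0∞ := fun i => (W i).rnDeriv (V i) with hr
  have hrm : ∀ i, Measurable (r i) := fun i => Measure.measurable_rnDeriv _ _
  have hW : ∀ i, (V i).withDensity (r i) = W i := fun i =>
    Measure.withDensity_rnDeriv_eq _ _ (absolutelyContinuous_of_lintegral_likelihoodRatio ht
      (ne_top_of_le_ne_top hL (h i)))
  have hmom : ∀ i, ∫⁻ y, r i y ^ (1 + t) ∂(V i) ≤ L := by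
    intro i
    refine le_trans (le_of_eq ?_) (h i)
    have h1 := lintegral_likelihoodRatio_rpow (ν := V i) (q := fun _ => 1) (hrm i)
      measurable_const (by rw [← setLIntegral_univ, ← withDensity_apply _ .univ, hW]; simp)
      (by simp) t
    rw [hW, show (V i).withDensity (fun _ => 1) = V i from withDensity_one] at h1
    rw [h1]
    refine lintegral_congr fun y => ?_
    rw [ENNReal.rpow_add_of_nonneg _ _ zero_le_one ht.le]
    simp
  have : ∀ i, SigmaFinite ((V i).withDensity (r i)) := fun i => by rw [hW]; infer_instance
  have hpi : Measure.pi W = (Measure.pi V).withDensity fun y => ∏ i, r i (y i) := by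
    rw [← pi_withDensity V hrm]
    simp_rw [hW]
  have hpq : (1 + t).HolderConjugate ((1 + t) / t) := by
    rw [Real.holderConjugate_iff]
    refine ⟨by linarith, ?_⟩
    field_simp
  have hRm : Measurable fun y : Fin n → Y => ∏ i, r i (y i) :=
    Finset.measurable_prod _ fun i _ => (hrm i).comp (measurable_pi_apply i)
  have hol := ENNReal.lintegral_mul_le_Lp_mul_Lq (Measure.pi V) hpq hRm.aemeasurable
    (measurable_const.indicator hA : Measurable (A.indicator fun _ => (1 : ℝ≥0∞))).aemeasurable
  have h1 : ∫⁻ y, ((fun y : Fin n → Y => ∏ i, r i (y i)) *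
      A.indicator fun _ => (1 : ℝ≥0∞)) y ∂(Measure.pi V)
      = Measure.pi W A := by
    rw [hpi, withDensity_apply _ hA, ← lintegral_indicator hA]
    refine lintegral_congr fun y => ?_
    by_cases hy : y ∈ A <;> simp [hy]
  have h2 : ∫⁻ y, (∏ i, r i (y i)) ^ (1 + t) ∂(Measure.pi V) ≤ L ^ n := by
    simp_rw [← ENNReal.prod_rpow_of_nonneg (show 0 ≤ 1 + t by linarith)]
    rw [lintegral_pi_prod V fun i => (hrm i).pow_const _]
    calc _ ≤ ∏ _i : Fin n, L := Finset.prod_le_prod' fun i _ => hmom i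
      _ = L ^ n := by simp
  have h3 : ∫⁻ y, (A.indicator (fun _ => (1 : ℝ≥0∞)) y) ^ ((1 + t) / t) ∂(Measure.pi V)
      = Measure.pi V A := by
    rw [← lintegral_indicator_one hA]
    refine lintegral_congr fun y => ?_
    have : 0 < (1 + t) / t := by positivity
    by_cases hy : y ∈ A <;> simp [hy, this]
  rw [h1, h3] at hol
  refine hol.trans ?_
  rw [one_div_div]
  gcongr

/-- The change of measure for the error probability of a code. The average over the messages is
taken inside the power by concavity of `v ↦ v ^ (t / (1 + t))`. -/
theorem Code.errorProb_le_of_moment {n : ℕ} (Φ : Code X Y n) (hΦ : Φ.size ≠ 0)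
    {W V : X → Measure Y} [∀ x, IsProbabilityMeasure (W x)] [∀ x, IsProbabilityMeasure (V x)]
    {t : ℝ} (ht : 0 < t) {L : ℝ≥0∞} (hL : L ≠ ∞)
    (h : ∀ x, ∫⁻ y, likelihoodRatio (W x) (V x) y ^ t ∂(W x) ≤ L) :
    Φ.errorProb W ≤ (L ^ n) ^ (1 / (1 + t)) * Φ.errorProb V ^ (t / (1 + t)) := by
  have herr : ∀ S : X → Measure Y, Φ.errorProb S = ∑ i, (Φ.size : ℝ≥0∞)⁻¹ *
      Measure.pi (fun t => S (Φ.encoder i t)) (Φ.decoder ⁻¹' {j | j ≠ i}) := by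
    intro S
    rw [Code.errorProb, Finset.mul_sum]
    refine Finset.sum_congr rfl fun i _ => ?_
    rw [← measure_biUnion_finset]
    · congr 2
      ext y
      simp
    · intro j _ l _ hjl
      exact Disjoint.preimage _ (by simpa using hjl)
    · exact fun j _ => Φ.measurable_decoder (measurableSet_singleton j)
  have hτ : 0 < t / (1 + t) := by positivity
  rw [herr, herr]
  set v : Fin Φ.size → ℝ≥0∞ := fun i =>
    Measure.pi (fun t => V (Φ.encoder i t)) (Φ.decoder ⁻¹' {j | j ≠ i}) with hv
  have hJ := ENNReal.rpow_arith_mean_le_arith_mean_rpow Finset.univ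
    (fun _ : Fin Φ.size => (Φ.size : ℝ≥0∞)⁻¹) (fun i => v i ^ (t / (1 + t)))
    (by simp [ENNReal.mul_inv_cancel, hΦ]) (p := (1 + t) / t) (by
      rw [le_div_iff₀ ht]; linarith)
  have hJ' : ∑ i, (Φ.size : ℝ≥0∞)⁻¹ * v i ^ (t / (1 + t))
      ≤ (∑ i, (Φ.size : ℝ≥0∞)⁻¹ * v i) ^ (t / (1 + t)) := by
    have h1 := ENNReal.rpow_le_rpow hJ hτ.le
    rw [← ENNReal.rpow_mul, show (1 + t) / t * (t / (1 + t)) = 1 by field_simp,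
      ENNReal.rpow_one] at h1
    refine h1.trans_eq ?_
    congr 1
    refine Finset.sum_congr rfl fun i _ => ?_
    rw [← ENNReal.rpow_mul, show t / (1 + t) * ((1 + t) / t) = 1 by field_simp, ENNReal.rpow_one]
  calc _ ≤ ∑ i, (Φ.size : ℝ≥0∞)⁻¹ * ((L ^ n) ^ (1 / (1 + t)) * v i ^ (t / (1 + t))) := by
        gcongr with i
        exact measure_pi_le_of_moment ht hL (fun _ => h _)
          (Φ.measurable_decoder (MeasurableSet.of_discrete))
    _ = (L ^ n) ^ (1 / (1 + t)) * ∑ i, (Φ.size : ℝ≥0∞)⁻¹ * v i ^ (t / (1 + t)) := by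
        rw [Finset.mul_sum]
        exact Finset.sum_congr rfl fun i _ => by ring
    _ ≤ _ := by gcongr

end Transfer

/-! ### Exponents along a countable dense subfamily -/

section Exponents

/-- A countable subset of `Θ` that is dense for the topology and along which, in addition, the
values of `E` are approached: a dense subset of the graph of `E`. -/
theorem exists_seq_dense_graph {α : Type*} [TopologicalSpace α] [SecondCountableTopology α]
    {Θ : Set α} (hΘ : Θ.Nonempty) (E : α → EReal) :
    ∃ u : ℕ → α, (∀ i, u i ∈ Θ) ∧
      ∀ θ ∈ Θ, ∀ V ∈ 𝓝[Θ] θ, ∀ c < E θ, ∃ i, u i ∈ V ∧ c < E (u i) := by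
  set S : Set (α × EReal) := (fun θ => (θ, E θ)) '' Θ with hS
  have : Nonempty S := (hΘ.image _).to_subtype
  have hd : ∀ i, ∃ θ ∈ Θ, (θ, E θ) = (TopologicalSpace.denseSeq S i : α × EReal) := fun i =>
    (TopologicalSpace.denseSeq S i).2
  choose u hu hu' using hd
  refine ⟨u, hu, fun θ hθ V hV c hc => ?_⟩
  obtain ⟨o, ho, hθo, hoV⟩ := mem_nhdsWithin.1 hV
  have hO : IsOpen ((↑) ⁻¹' (o ×ˢ Set.Ioi c) : Set S) :=
    (ho.prod isOpen_Ioi).preimage continuous_subtype_val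
  obtain ⟨i, hi⟩ := (TopologicalSpace.denseRange_denseSeq S).exists_mem_open hO
    ⟨⟨(θ, E θ), ⟨θ, hθ, rfl⟩⟩, ⟨hθo, hc⟩⟩
  rw [Set.mem_preimage, ← hu' i] at hi
  exact ⟨i, hoV ⟨hi.1, hu i⟩, hi.2⟩

variable {X Y : Type*} [Fintype X] [MeasurableSpace Y]

/-- Countably many probability measures have finite-valued densities with respect to a common
σ-finite measure; the measure `μ` of the channel family need not be σ-finite, and product measures
need that. -/
theorem exists_common_density (W : ℕ → X → Measure Y) [∀ i x, IsProbabilityMeasure (W i x)] :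
    ∃ (ν : Measure Y) (f : ℕ → X → Y → ℝ≥0∞), SigmaFinite ν ∧ (∀ i x, Measurable (f i x)) ∧
      (∀ i x y, f i x y ≠ ∞) ∧ ∀ i x, ν.withDensity (f i x) = W i x := by
  set ν : Measure Y := (Measure.sum fun j : ℕ × X => W j.1 j.2).toFinite with hν
  have hac : ∀ i x, W i x ≪ ν := fun i x =>
    (Measure.absolutelyContinuous_of_le
      (Measure.le_sum (fun j : ℕ × X => W j.1 j.2) (i, x))).trans
      (absolutelyContinuous_toFinite _)
  refine ⟨ν, fun i x y => ((W i x).rnDeriv ν y).toNNReal, inferInstance, fun i x => ?_,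
    fun i x y => ENNReal.coe_ne_top, fun i x => ?_⟩
  · exact (Measure.measurable_rnDeriv _ _).ennreal_toNNReal.coe_nnreal_ennreal
  · conv_rhs => rw [← Measure.withDensity_rnDeriv_eq _ _ (hac i x)]
    refine withDensity_congr_ae ?_
    filter_upwards [Measure.rnDeriv_lt_top (W i x) ν] with y hy
    exact ENNReal.coe_toNNReal hy.ne

/-- Codes for a countable family of channels: every lower bound `a` on both exponents of the
`i`-th channel is attained up to a constant factor. -/
theorem exists_codes_countable (W : ℕ → X → Measure Y) [∀ i x, IsProbabilityMeasure (W i x)]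
    {p : X → ℝ≥0∞} (hp : ∑ x, p x = 1) (R R₁ : ℝ) :
    ∃ Φ : (n : ℕ) → Code X Y n, (∀ n, (Φ n).size = ⌈Real.exp (n * R)⌉₊) ∧
      ∀ i (s a : ℝ), 0 ≤ s → a ≤ R₁ - R →
        (∀ Q : ProbabilityMeasure Y, ∑ x, p x *
          ∫⁻ y, likelihoodRatio (W i x) Q y ^ (-s) ∂(W i x)
            ≤ ENNReal.ofReal (Real.exp (-(a + s * R₁)))) →
        ∃ C : ℝ≥0∞, C ≠ ∞ ∧
          ∀ n : ℕ, (Φ n).errorProb (W i) ≤ C * ENNReal.ofReal (Real.exp (-(n * a))) := by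
  obtain ⟨ν, f, _, hf, hft, hW⟩ := exists_common_density W
  have hf1 : ∀ i x, ∫⁻ y, f i x y ∂ν = 1 := fun i x => by
    rw [← setLIntegral_univ, ← withDensity_apply _ .univ, hW]; simp
  obtain ⟨lam', hlam0, hlam⟩ := ENNReal.exists_pos_sum_of_countable (one_ne_zero (α := ℝ≥0∞)) ℕ
  set lam : ℕ → ℝ≥0∞ := fun i => lam' i
  have hlam0' : ∀ i, lam i ≠ 0 := fun i => by simpa [lam] using (hlam0 i).ne'
  have key : ∀ n : ℕ, ∃ Φ : Code X Y n, Φ.size = ⌈Real.exp (n * R)⌉₊ ∧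
      ∀ i (s : ℝ) (g : ℝ≥0∞), 0 ≤ s →
      (∀ Q : ProbabilityMeasure Y, ∑ x, p x *
        ∫⁻ y, likelihoodRatio (W i x) Q y ^ (-s) ∂(W i x) ≤ g) →
      Φ.errorProb (W i)
        ≤ ((ENNReal.ofReal (Real.exp (n * R₁)) / lam i) ^ s * g ^ n
          + ENNReal.ofReal (Real.exp (n * R)) *
            ((ENNReal.ofReal (Real.exp (n * R₁)))⁻¹ / lam i)) / lam i := by
    intro n
    have h := exists_code_countable (ν := ν) hf hft hf1 hp hlam.le hlam0' n
      (M := ⌈Real.exp (n * R)⌉₊) (Nat.ceil_pos.2 (Real.exp_pos _)).ne'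
      (N := ENNReal.ofReal (Real.exp (n * R))) (c := ENNReal.ofReal (Real.exp (n * R₁)))
      (by
        rw [← ENNReal.ofReal_natCast, ← ENNReal.ofReal_one,
          ← ENNReal.ofReal_add (Real.exp_pos _).le zero_le_one]
        exact ENNReal.ofReal_le_ofReal (Nat.ceil_lt_add_one (Real.exp_pos _).le).le)
      (by simp [Real.exp_pos]) ENNReal.ofReal_ne_top (by simp [Real.exp_pos])
      ENNReal.ofReal_ne_top
    simpa only [hW] using h
  choose Φ hsize hΦ using key
  refine ⟨Φ, hsize, fun i s a hs ha hg => ?_⟩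
  have hli : (lam i)⁻¹ ≠ ∞ := ENNReal.inv_ne_top.2 (hlam0' i)
  refine ⟨((lam i)⁻¹ ^ s + (lam i)⁻¹) / lam i, ENNReal.div_ne_top (ENNReal.add_ne_top.2
    ⟨ENNReal.rpow_ne_top_of_nonneg hs hli, hli⟩) (hlam0' i), fun n => ?_⟩
  refine (hΦ n i s _ hs hg).trans ?_
  have h1 : (ENNReal.ofReal (Real.exp (n * R₁)) / lam i) ^ s
      * ENNReal.ofReal (Real.exp (-(a + s * R₁))) ^ n
      = (lam i)⁻¹ ^ s * ENNReal.ofReal (Real.exp (-(n * a))) := by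
    rw [div_eq_mul_inv, ENNReal.mul_rpow_of_nonneg _ _ hs, mul_comm (_ ^ s), mul_assoc,
      ENNReal.ofReal_rpow_of_pos (Real.exp_pos _), ← ENNReal.ofReal_pow (Real.exp_pos _).le,
      ← ENNReal.ofReal_mul (by positivity), ← Real.exp_mul, ← Real.exp_nat_mul, ← Real.exp_add]
    congr 3
    ring
  have h2 : ENNReal.ofReal (Real.exp (n * R)) *
      ((ENNReal.ofReal (Real.exp (n * R₁)))⁻¹ / lam i)
      ≤ (lam i)⁻¹ * ENNReal.ofReal (Real.exp (-(n * a))) := by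
    rw [div_eq_mul_inv, ← mul_assoc, mul_comm]
    refine mul_le_mul_right ?_ _
    rw [← ENNReal.ofReal_inv_of_pos (Real.exp_pos _), ← ENNReal.ofReal_mul (Real.exp_pos _).le,
      ← Real.exp_neg, ← Real.exp_add]
    refine ENNReal.ofReal_le_ofReal (Real.exp_le_exp.2 ?_)
    nlinarith [(Nat.cast_nonneg n : (0 : ℝ) ≤ n)]
  rw [h1, ← ENNReal.mul_div_right_comm, add_mul]
  exact ENNReal.div_le_div_right (add_le_add le_rfl h2) _

theorem sum_moment_le_of_lt_sInfo {P : X → ℝ} {W : X → Measure Y} {s r a : ℝ}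
    (h : (a : EReal) < sInfo s P W - (r : EReal)) (Q : ProbabilityMeasure Y) :
    ∑ x, ENNReal.ofReal (P x) * ∫⁻ y, likelihoodRatio (W x) Q y ^ (-s) ∂(W x)
      ≤ ENNReal.ofReal (Real.exp (-(a + r))) := by
  have h1 := le_iSup (fun Q : ProbabilityMeasure Y => ENNReal.log (∑ x,
    ENNReal.ofReal (P x) * EReal.exp (sRenyiDiv (-s) (W x) (Q : Measure Y)))) Q
  simp only [sRenyiDiv, ENNReal.exp_log] at h1
  rw [← ENNReal.log_le_log_iff, ENNReal.log_ofReal_of_pos (Real.exp_pos _), Real.log_exp]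
  refine h1.trans ?_
  simp only [sInfo, sRenyiDiv, ENNReal.exp_log] at h
  generalize (⨆ Q : ProbabilityMeasure Y, ENNReal.log (∑ x, ENNReal.ofReal (P x) *
    ∫⁻ y, likelihoodRatio (W x) Q y ^ (-s) ∂(W x))) = S at h
  induction S with
  | bot => exact bot_le
  | top => simp at h
  | coe S =>
    have h' : a < -S - r := by exact_mod_cast h
    exact_mod_cast (by linarith : S ≤ -(a + r))

theorem le_neg_div_mul_log {e : ℝ≥0∞} {n : ℕ} (hn : 0 < n) {a : ℝ}
    (h : e ≤ ENNReal.ofReal (Real.exp (-(n * a)))) :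
    (a : EReal) ≤ ((-1 / n : ℝ) : EReal) * ENNReal.log e := by
  have hn' : (0 : ℝ) < n := by exact_mod_cast hn
  have h1 := ENNReal.log_le_log h
  rw [ENNReal.log_ofReal_of_pos (Real.exp_pos _), Real.log_exp] at h1
  generalize ENNReal.log e = L at h1
  induction L with
  | bot =>
    rw [EReal.coe_mul_bot_of_neg (div_neg_of_neg_of_pos (by norm_num) hn')]
    exact le_top
  | top => exact absurd (top_le_iff.1 h1) (EReal.coe_ne_top _)
  | coe L =>
    have h2 : L ≤ -(n * a) := by exact_mod_cast h1
    have h3 : a ≤ -1 / n * L := by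
      rw [div_mul_eq_mul_div, le_div_iff₀ hn']
      linarith
    exact_mod_cast h3

theorem eventually_error_le {D : ℝ≥0∞} (hD : D ≠ ∞) {e : ℕ → ℝ≥0∞} {a δ : ℝ} (hδ : 0 < δ)
    (h : ∀ n : ℕ, e n ≤ D * ENNReal.ofReal (Real.exp (-(n * (a + δ))))) :
    ∀ᶠ n : ℕ in atTop, e n ≤ ENNReal.ofReal (Real.exp (-(n * a))) := by
  have hlim : Tendsto (fun n : ℕ => Real.exp (n * δ)) atTop atTop :=
    Real.tendsto_exp_atTop.comp (tendsto_natCast_atTop_atTop.atTop_mul_const hδ)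
  filter_upwards [hlim.eventually_ge_atTop D.toReal] with n hn
  refine (h n).trans ?_
  rw [← ENNReal.ofReal_toReal hD, ← ENNReal.ofReal_mul ENNReal.toReal_nonneg]
  refine ENNReal.ofReal_le_ofReal ?_
  calc D.toReal * Real.exp (-(n * (a + δ))) ≤ Real.exp (n * δ) * Real.exp (-(n * (a + δ))) := by
        gcongr
    _ = Real.exp (-(n * a)) := by
        rw [← Real.exp_add]; congr 1; ring

end Exponents

/-! ### Moments of the likelihood ratio near a parameter -/

section Regularity

variable {X Y : Type*} [Fintype X] [MeasurableSpace Y]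

theorem lintegral_likelihoodRatio_le_of_renyiDiv_lt {P Q : Measure Y} {t ε : ℝ} (ht : 0 < t)
    (h : renyiDiv t P Q < ((ε / t : ℝ) : EReal)) :
    ∫⁻ y, likelihoodRatio P Q y ^ t ∂P ≤ ENNReal.ofReal (Real.exp ε) := by
  rw [← ENNReal.log_le_log_iff, ENNReal.log_ofReal_of_pos (Real.exp_pos _), Real.log_exp]
  rw [renyiDiv, sRenyiDiv] at h
  generalize ENNReal.log (∫⁻ y, likelihoodRatio P Q y ^ t ∂P) = L at h
  induction L with
  | bot => exact bot_le
  | top =>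
    rw [EReal.coe_mul_top_of_pos (inv_pos.2 ht)] at h
    exact absurd h not_top_lt
  | coe L =>
    have h' : t⁻¹ * L < ε / t := by exact_mod_cast h
    rw [inv_mul_eq_div, div_lt_div_iff_of_pos_right ht] at h'
    exact_mod_cast h'.le

/-- The divergence vanishes at the diagonal point `(θ, θ)` and is continuous there. -/
theorem DivergenceRegular.eventually_moment_le {μ : Measure Y} {k : X → ℕ} {Θ : Set (Param k)}
    {w : Param k → X → Y → ℝ} {𝒦 : Set (Set (Param k))} (h : DivergenceRegular μ Θ w 𝒦)
    {θ : Param k} (hθ : θ ∈ Θ) (x : X) [IsProbabilityMeasure (outputLaw μ (w θ) x)] {t ε : ℝ}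
    (ht : 0 < t) (hε : 0 < ε) :
    ∀ᶠ θ' in 𝓝[Θ] θ, ∫⁻ y, likelihoodRatio (outputLaw μ (w θ) x) (outputLaw μ (w θ') x) y ^ t
      ∂(outputLaw μ (w θ) x) ≤ ENNReal.ofReal (Real.exp ε) := by
  have hc := ((h x).1 t ht) (θ, θ) ⟨hθ, hθ⟩
  have hm : Tendsto (fun θ' => (θ, θ')) (𝓝[Θ] θ) (𝓝[Θ ×ˢ Θ] (θ, θ)) := by
    refine tendsto_nhdsWithin_iff.2 ⟨?_, ?_⟩
    · exact (Continuous.prodMk_right θ).continuousAt.tendsto.mono_left nhdsWithin_le_nhds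
    · filter_upwards [self_mem_nhdsWithin] with θ' hθ'
      exact ⟨hθ, hθ'⟩
  have hlim := hc.tendsto.comp hm
  have h0 : renyiDiv t (outputLaw μ (w θ) x) (outputLaw μ (w θ) x) = 0 := by
    simp [renyiDiv, sRenyiDiv, lintegral_likelihoodRatio_self]
  simp only [h0] at hlim
  have hpos : (0 : EReal) < ((ε / t : ℝ) : EReal) := by
    exact_mod_cast div_pos hε ht
  filter_upwards [hlim.eventually_lt_const hpos] with θ' hθ'
  exact lintegral_likelihoodRatio_le_of_renyiDiv_lt ht hθ'

theorem ofReal_mul_div_rpow_exp {v a b t : ℝ} (hv : 0 ≤ v) :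
    ENNReal.ofReal (v * Real.exp a)
        * (ENNReal.ofReal (v * Real.exp a) / ENNReal.ofReal (v * Real.exp b)) ^ t
      = ENNReal.ofReal (v * Real.exp (a + t * (a - b))) := by
  rcases hv.eq_or_lt with rfl | hv
  · simp
  · rw [← ENNReal.ofReal_div_of_pos (by positivity), mul_div_mul_left _ _ hv.ne', ← Real.exp_sub,
      ENNReal.ofReal_rpow_of_pos (Real.exp_pos _), ← ENNReal.ofReal_mul (by positivity),
      ← Real.exp_mul, mul_assoc, ← Real.exp_add, mul_comm t]

/-- In an exponential family the moment of order `t` of the likelihood ratio of `θ` to `θ'` is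
`exp (φ ((1 + t) θ - t θ') - (1 + t) φ θ + t φ θ')`, which tends to one as `θ'` tends to `θ`. -/
theorem ConditionA.eventually_moment_le {μ : Measure Y} {k : X → ℕ} {Θ : Set (Param k)}
    {w : Param k → X → Y → ℝ} (hw : ∀ θ ∈ Θ, IsChannelDensity μ (w θ))
    (h : ConditionA μ k Θ w)
    {θ : Param k} (hθ : θ ∈ Θ) (x : X) {t ε : ℝ} (hε : 0 < ε) :
    ∀ᶠ θ' in 𝓝[Θ] θ, ∫⁻ y, likelihoodRatio (outputLaw μ (w θ) x) (outputLaw μ (w θ') x) y ^ t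
      ∂(outputLaw μ (w θ) x) ≤ ENNReal.ofReal (Real.exp ε) := by
  obtain ⟨w₀, g, φ, U, hw₀, hg, hU, hΘU, hexp, hφ, hC⟩ := h
  have hφc : ContinuousAt (φ x) θ := (hC x).continuousOn.continuousAt (hU.mem_nhds (hΘU hθ))
  set τ : Param k → Param k := fun θ' => (1 + t) • θ - t • θ' with hτ
  have hτθ : τ θ = θ := by simp [hτ, add_smul]
  have hτc : ContinuousAt τ θ := by fun_prop
  have hUτ : ∀ᶠ θ' in 𝓝 θ, τ θ' ∈ U :=
    hτc.eventually_mem (by rw [hτθ]; exact hU.mem_nhds (hΘU hθ))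
  have hlim : ContinuousAt (fun θ' => φ x (τ θ') - (1 + t) * φ x θ + t * φ x θ') θ := by
    have h1 : ContinuousAt (fun θ' => φ x (τ θ')) θ :=
      ContinuousAt.comp (g := φ x) (by rw [hτθ]; exact hφc) hτc
    exact (h1.sub continuousAt_const).add (continuousAt_const.mul hφc)
  have hsmall : ∀ᶠ θ' in 𝓝 θ, φ x (τ θ') - (1 + t) * φ x θ + t * φ x θ' < ε := by
    refine hlim.eventually_lt continuousAt_const ?_
    simp only [hτθ]
    linarith
  filter_upwards [hUτ.filter_mono nhdsWithin_le_nhds, hsmall.filter_mono nhdsWithin_le_nhds,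
    self_mem_nhdsWithin] with θ' h1 h2 hθ'
  have hd := hw θ hθ x
  have hd' := hw θ' hθ' x
  have hI := lintegral_likelihoodRatio_rpow (ν := μ) (hd.1.ennreal_ofReal) (hd'.1.ennreal_ofReal)
    (by simp [hd.2.2]) (by simp [hd'.2.2]) t
  rw [outputLaw, outputLaw, hI]
  calc ∫⁻ y, ENNReal.ofReal (w θ x y) * (ENNReal.ofReal (w θ x y) / ENNReal.ofReal (w θ' x y)) ^ t
        ∂μ
      = ∫⁻ y, ENNReal.ofReal (w₀ x y * Real.exp (∑ j, τ θ' ⟨x, j⟩ * g x j y))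
          * ENNReal.ofReal (Real.exp (-((1 + t) * φ x θ) + t * φ x θ')) ∂μ := by
        refine lintegral_congr_ae ?_
        filter_upwards [hexp θ hθ x, hexp θ' hθ' x] with y e e'
        rw [e, e', ofReal_mul_div_rpow_exp ((hw₀ x).2.1 y),
          ← ENNReal.ofReal_mul (mul_nonneg ((hw₀ x).2.1 y) (Real.exp_pos _).le), mul_assoc,
          ← Real.exp_add]
        congr 3
        have : ∑ j, τ θ' ⟨x, j⟩ * g x j y
            = (1 + t) * ∑ j, θ ⟨x, j⟩ * g x j y - t * ∑ j, θ' ⟨x, j⟩ * g x j y := by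
          rw [Finset.mul_sum, Finset.mul_sum, ← Finset.sum_sub_distrib]
          refine Finset.sum_congr rfl fun j _ => ?_
          simp only [hτ, PiLp.sub_apply, PiLp.smul_apply, smul_eq_mul]
          ring
        rw [this]
        ring
    _ = ENNReal.ofReal (Real.exp (φ x (τ θ')))
          * ENNReal.ofReal (Real.exp (-((1 + t) * φ x θ) + t * φ x θ')) := by
        rw [lintegral_mul_const' _ _ ENNReal.ofReal_ne_top, hφ _ h1]
    _ ≤ ENNReal.ofReal (Real.exp ε) := by
        rw [← ENNReal.ofReal_mul (Real.exp_pos _).le, ← Real.exp_add]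
        gcongr
        linarith

end Regularity

end UniversalChannel

/-! ### Universal codes -/

open UniversalChannel in
theorem theorem1 {X Y : Type*} [Fintype X] [MeasurableSpace Y] (μ : Measure Y)
    (k : X → ℕ) (Θ : Set (Param k)) (w : Param k → X → Y → ℝ)
    (hw : ∀ θ ∈ Θ, IsChannelDensity μ (w θ))
    (hcond : ConditionA μ k Θ w ∨ ConditionB μ k Θ w ∨ ConditionC μ k Θ w)
    (P : X → ℝ) (hP : P ∈ stdSimplex ℝ X) (R R₁ : ℝ) :
    ∃ Φ : (n : ℕ) → Code X Y n,
      (∀ n, (Φ n).size = ⌈Real.exp (n * R)⌉₊) ∧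
      ∀ θ ∈ Θ,
        min (⨆ s ∈ Set.Icc (0 : ℝ) 1,
              (sInfo s P (outputLaw μ (w θ)) - ((s * R₁ : ℝ) : EReal)))
            ((R₁ - R : ℝ) : EReal)
          ≤ liminf (fun n : ℕ =>
              (((-1 / n : ℝ)) : EReal) * ENNReal.log ((Φ n).errorProb (outputLaw μ (w θ)))) atTop := by
  have hprob : ∀ θ ∈ Θ, ∀ x, IsProbabilityMeasure (outputLaw μ (w θ) x) := fun θ hθ x =>
    ⟨by simp [outputLaw, (hw θ hθ x).2.2]⟩
  have hp : ∑ x, ENNReal.ofReal (P x) = 1 := by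
    rw [← ENNReal.ofReal_sum_of_nonneg fun x _ => hP.1 x, hP.2, ENNReal.ofReal_one]
  rcases Θ.eq_empty_or_nonempty with rfl | hΘ
  · -- Without parameters any codes of the right size will do.
    obtain ⟨x⟩ : Nonempty X := by
      by_contra h
      have : IsEmpty X := not_nonempty_iff.1 h
      simp at hp
    refine ⟨fun n => ⟨⌈Real.exp (n * R)⌉₊, fun _ _ => x,
      fun _ => ⟨0, Nat.ceil_pos.2 (Real.exp_pos _)⟩, measurable_const⟩, fun n => rfl, ?_⟩
    simp
  set E : Param k → EReal := fun θ => ⨆ s ∈ Set.Icc (0 : ℝ) 1,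
    (sInfo s P (outputLaw μ (w θ)) - ((s * R₁ : ℝ) : EReal)) with hE
  have hreg : ∀ θ ∈ Θ, ∀ t ε : ℝ, 0 < t → 0 < ε → ∀ᶠ θ' in 𝓝[Θ] θ, ∀ x,
      ∫⁻ y, likelihoodRatio (outputLaw μ (w θ) x) (outputLaw μ (w θ') x) y ^ t
        ∂(outputLaw μ (w θ) x) ≤ ENNReal.ofReal (Real.exp ε) := by
    intro θ hθ t ε ht hε
    refine eventually_all.2 fun x => ?_
    have := hprob θ hθ x
    rcases hcond with h | h | h
    · exact h.eventually_moment_le hw hθ x hε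
    · exact h.2.eventually_moment_le hθ x ht hε
    · exact h.2.eventually_moment_le hθ x ht hε
  obtain ⟨u, huΘ, hu⟩ := exists_seq_dense_graph hΘ E
  have : ∀ i x, IsProbabilityMeasure (outputLaw μ (w (u i)) x) := fun i => hprob _ (huΘ i)
  obtain ⟨Φ, hsize, hΦ⟩ := exists_codes_countable (fun i => outputLaw μ (w (u i))) hp R R₁
  refine ⟨Φ, hsize, fun θ hθ => ?_⟩
  have := hprob θ hθ
  refine le_of_forall_lt fun c hc => ?_
  obtain ⟨a, hca, ha⟩ := EReal.lt_iff_exists_real_btwn.1 hc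
  obtain ⟨a', haa', ha'⟩ := EReal.lt_iff_exists_real_btwn.1 ha
  have haa' : a < a' := by exact_mod_cast haa'
  have ha'R : a' ≤ R₁ - R := by exact_mod_cast (ha'.trans_le (min_le_right _ _)).le
  have ha'E : (a' : EReal) < E θ := ha'.trans_le (min_le_left _ _)
  -- An order `t` so large that the change of measure costs only the small factor `t / (1 + t)`.
  obtain ⟨t, ht, hat⟩ : ∃ t : ℝ, 0 < t ∧ a < t / (1 + t) * a' := by
    refine ⟨1 + |a'| / (a' - a), by have := sub_pos.2 haa'; positivity, ?_⟩
    have hd := sub_pos.2 haa'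
    rw [div_mul_eq_mul_div, lt_div_iff₀ (by positivity)]
    have : |a'| / (a' - a) * (a' - a) = |a'| := div_mul_cancel₀ _ hd.ne'
    nlinarith [le_abs_self a', neg_abs_le a']
  set δ : ℝ := (t / (1 + t) * a' - a) / 2 with hδ
  have hδ0 : 0 < δ := by simp only [hδ]; linarith
  obtain ⟨i, hi, hiE⟩ := hu θ hθ _
    (hreg θ hθ t ((1 + t) * δ) ht (by positivity)) a' ha'E
  obtain ⟨s, hs, hsa⟩ : ∃ s ∈ Set.Icc (0 : ℝ) 1, (a' : EReal)
      < sInfo s P (outputLaw μ (w (u i))) - ((s * R₁ : ℝ) : EReal) := by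
    simpa only [hE, lt_iSup_iff, exists_prop] using hiE
  obtain ⟨C, hC, hCn⟩ := hΦ i s a' hs.1 ha'R (sum_moment_le_of_lt_sInfo hsa)
  refine hca.trans_le (le_liminf_of_le (by isBoundedDefault) ?_)
  have hτ : 0 < t / (1 + t) := by positivity
  have hbound : ∀ n : ℕ, (Φ n).errorProb (outputLaw μ (w θ))
      ≤ C ^ (t / (1 + t)) * ENNReal.ofReal (Real.exp (-(n * (a + δ)))) := by
    intro n
    have h1 := (Φ n).errorProb_le_of_moment
      (by rw [hsize]; exact (Nat.ceil_pos.2 (Real.exp_pos _)).ne') ht ENNReal.ofReal_ne_top hi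
    refine h1.trans ((mul_le_mul_right (ENNReal.rpow_le_rpow (hCn n) hτ.le) _).trans_eq ?_)
    rw [ENNReal.mul_rpow_of_nonneg _ _ hτ.le, ← ENNReal.ofReal_pow (Real.exp_pos _).le,
      ENNReal.ofReal_rpow_of_pos (by positivity), ENNReal.ofReal_rpow_of_pos (Real.exp_pos _),
      mul_left_comm, ← ENNReal.ofReal_mul (by positivity), ← Real.exp_nat_mul, ← Real.exp_mul,
      ← Real.exp_mul, ← Real.exp_add]
    congr 3
    simp only [hδ]
    field_simp
    ring
  filter_upwards [eventually_error_le (ENNReal.rpow_ne_top_of_nonneg hτ.le hC) hδ0 hbound,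
    eventually_gt_atTop 0] with n hn hn0
  exact le_neg_div_mul_log hn0 hn
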